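/- Let $p$ be a prime, $s\ge 1$ an integer, $\underline a=(a_1,\dots,a_s)\in\mathbb Z_p^s$ and $\underline b=(b_1,\dots,b_{s-1})\in(\mathbb Z_p\setminus\mathbb Z_{\le 0})^{s-1}$. For $\alpha\in\mathbb Z_p$ let $[\alpha]_0\in\{0,\dots,p-1\}$ be the integer with $\alpha+[\alpha]_0\equiv 0 \pmod p$, let $\alpha'=(\alpha+[\alpha]_0)/p$ be its Dwork prime, and put $\alpha^{(0)}=\alpha$, $\alpha^{(i)}=(\alpha^{(i-1)})'$ and $[\alpha]_n=[\alpha^{(n)}]_0$, so that $\alpha=-\sum_{n\ge0}[\alpha]_np^n$. Let $q$ be the number of indices $j$ with $b_j\ne1$. Suppose that (i) $|b_j^{(i)}|_p=1$ for all $i\ge0$ and all $j$ with $b_j\neq 1$; (ii) for each fixed $n\ge0$, if the indices are rearranged so that $[a_1]_n\le\cdots\le[a_s]_n$ and $[b_1]_n\le\cdots\le[b_{s-1}]_n$, then $[a_{j+1}]_n<[b_j]_n$ for $j=1,\dots,q$; and that $a_i\notin\mathbb Z_{\le0}$ for all $i$. Write $(\alpha)_n=\alpha(\alpha+1)\cdots(\alpha+n-1)$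 and $$F_{\underline a,\underline b}(t)=\sum_{n\ge0}\frac{(a_1)_n\cdots(a_s)_n}{(b_1)_n\cdots(b_{s-1})_n(1)_n}t^n,$$ and let $F^{(1)}_{\underline a,\underline b}(t)$ be the same series with all $a_i,b_j$ replaced by $a_i',b_j'$. Let $W=W(\overline{\mathbb F}_p)$ be the Witt ring of $\overline{\mathbb F}_p$, with Frobenius $w\mapsto w^F$, and $K=\operatorname{Frac}W$ with the induced Frobenius. Let $c\in1+pW$ and let $\sigma$ be given by $\left(\sum_i w_it^i\right)^\sigma=\sum_i w_i^Fc^it^{ip}$. Let $\log$ be the Iwasawa logarithm, and put $$\gamma_p=\lim_{m\to\infty}\frac1{p^m}\sum_{0\le j<p^m,\ p\nmid j}\log(j),\qquad \psi_p(z)=-\gamma_p+\lim_{n\in\mathbb Z_{>0},\ n\to z}\ \sum_{1\le k<n,\ p\nmid k}\frac1k\quad(z\in\mathbb Z_p),$$ $$G_{\underline a,\underline b}(t)=\sum_{i=1}^s\psi_p(a_i)-\sum_{j=1}^{s-1}\psi_p(b_j)+\gamma_p-p^{-1}\log(c)+\int_0^t\left(F_{\underline a,\underline b}(t)-F^{(1)}_{\underline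 a,\underline b}(t^\sigma)\right)\frac{dt}t\in K[[t]],$$ where $F^{(1)}_{\underline a,\underline b}(t^\sigma)$ denotes $\left(F^{(1)}_{\underline a,\underline b}(t)\right)^\sigma$ and $\int_0^t(-)\frac{dt}t$ sends $\sum_{n\ge1}x_nt^n$ to $\sum_{n\ge1}\frac{x_n}nt^n$. Define the generalized $p$-adic hypergeometric function of logarithmic type by $\mathscr F^{(\sigma)}_{\underline a,\underline b}(t)=G_{\underline a,\underline b}(t)/F_{\underline a,\underline b}(t)$, and for $f=\sum x_it^i$ write $[f]_{<m}=\sum_{i<m}x_it^i$. Then $\mathscr F^{(\sigma)}_{\underline a,\underline b}(t)\in W[[t]]$. If $p$ is odd, then for all $n\ge1$ $$\mathscr F^{(\sigma)}_{\underline a,\underline b}(t)\equiv\frac{[G_{\underline a,\underline b}(t)]_{<p^n}}{[F_{\underline a,\underline b}(t)]_{<p^n}}\pmod{p^nW[[t]]}.$$ If $p=2$, then for all $n\ge1$ the same congruence holds modulo $p^{n-1}W[[t]]$. -/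

import Mathlib

open Filter Topology PowerSeries

noncomputable section

namespace LogHyp

/-! ### Dwork primes and digits -/

section Dwork

variable {p : ℕ} [Fact p.Prime]

/-- The integer `l ∈ {0, …, p-1}` with `α + l ≡ 0 mod p`. -/
def lastDigit (α : ℤ_[p]) : ℕ := (-α).zmodRepr

theorem dvd_add_lastDigit (α : ℤ_[p]) : (p : ℤ_[p]) ∣ α + (lastDigit α : ℤ_[p]) := by
  have h := PadicInt.sub_zmodRepr_mem (-α)
  rw [PadicInt.maximalIdeal_eq_span_p, Ideal.mem_span_singleton] at h
  have h2 := (dvd_neg (a := (p : ℤ_[p]))).2 h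
  have e : -(-α - ((-α).zmodRepr : ℤ_[p])) = α + (lastDigit α : ℤ_[p]) := by
    unfold lastDigit; ring
  rwa [e] at h2

/-- The Dwork prime `α' = (α + l) / p`. -/
def dworkPrime (α : ℤ_[p]) : ℤ_[p] := (dvd_add_lastDigit α).choose

theorem mul_dworkPrime (α : ℤ_[p]) :
    (p : ℤ_[p]) * dworkPrime α = α + (lastDigit α : ℤ_[p]) :=
  (dvd_add_lastDigit α).choose_spec.symm

/-- The iterated Dwork prime `α^{(i)}`. -/
def dworkIter (i : ℕ) (α : ℤ_[p]) : ℤ_[p] := dworkPrime^[i] α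

/-- The digit `[α]_n` in the expansion `α = -[α]_0 - [α]_1 p - [α]_2 p^2 - ⋯`. -/
def dworkDigit (n : ℕ) (α : ℤ_[p]) : ℕ := lastDigit (dworkIter n α)

/-- Dwork's conditions on `a = (a_1, …, a_{r+1})` and `b = (b_1, …, b_r)`, where `q` is the number
of indices `j` with `b_j ≠ 1`:
(i) `|b_j^{(i)}| = 1` for all `i` and all `j` with `b_j ≠ 1`;
(ii) for every `n`, once `a` and `b` are rearranged so that `[a_1]_n ≤ ⋯ ≤ [a_{r+1}]_n` and
`[b_1]_n ≤ ⋯ ≤ [b_r]_n`, one has `[a_{j+1}]_n < [b_j]_n` for `1 ≤ j ≤ q`. -/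
structure DworkConditions {r : ℕ} (a : Fin (r + 1) → ℤ_[p]) (b : Fin r → ℤ_[p]) : Prop where
  norm_eq_one : ∀ j, b j ≠ 1 → ∀ i, ‖dworkIter i (b j)‖ = 1
  digit_lt : ∀ (n : ℕ) (e : Equiv.Perm (Fin (r + 1))) (f : Equiv.Perm (Fin r)),
    Monotone (fun i => dworkDigit n (a (e i))) →
    Monotone (fun j => dworkDigit n (b (f j))) →
    ∀ j : Fin r, (j : ℕ) < {j | b j ≠ 1}.ncard →
      dworkDigit n (a (e j.succ)) < dworkDigit n (b (f j))

/-- The hypergeometric series `∑ (a_1)_n ⋯ (a_{r+1})_n / ((b_1)_n ⋯ (b_r)_n (1)_n) t^n`. -/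
def hypSeries {r : ℕ} (a : Fin (r + 1) → ℤ_[p]) (b : Fin r → ℤ_[p]) : ℚ_[p]⟦X⟧ :=
  PowerSeries.mk fun n =>
    (∏ i, (ascPochhammer ℚ_[p] n).eval (a i : ℚ_[p])) /
      ((∏ j, (ascPochhammer ℚ_[p] n).eval (b j : ℚ_[p])) * (ascPochhammer ℚ_[p] n).eval 1)

/-- `ψ̃_p(z)`, the limit of `∑_{1 ≤ k < n, p ∤ k} 1/k` as the positive integer `n` tends
`p`-adically to `z`. -/
def psiTilde (z : ℤ_[p]) : ℚ_[p] :=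
  limUnder (comap (fun n : ℕ => (n : ℤ_[p])) (𝓝 z) ⊓ 𝓟 {n | 0 < n})
    (fun n : ℕ => ∑ k ∈ (Finset.Ico 1 n).filter (fun k => ¬ p ∣ k), (1 / (k : ℚ_[p])))

end Dwork

/-! ### The Witt ring of the algebraic closure of `𝔽_p` and its fraction field -/

section Witt

variable (p : ℕ) [Fact p.Prime]

/-- `W = W(𝔽̄_p)`. -/
abbrev W : Type := WittVector p (AlgebraicClosure (ZMod p))

/-- `K = Frac W`. -/
abbrev K : Type := FractionRing (W p)

/-- The inclusion `ℤ_p = W(𝔽_p) → W(𝔽̄_p)`. -/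
def zpToW : ℤ_[p] →+* W p :=
  (WittVector.map (algebraMap (ZMod p) (AlgebraicClosure (ZMod p)))).comp
    (WittVector.equiv p).symm.toRingHom

theorem zpToW_injective : Function.Injective (zpToW p) :=
  (WittVector.map_injective _ (algebraMap (ZMod p) (AlgebraicClosure (ZMod p))).injective).comp
    (WittVector.equiv p).symm.injective

/-- The inclusion `ℚ_p → K`. -/
def qpToK : ℚ_[p] →+* K p :=
  IsFractionRing.lift (A := ℤ_[p]) (g := (algebraMap (W p) (K p)).comp (zpToW p))
    ((IsFractionRing.injective (W p) (K p)).comp (zpToW_injective p))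

variable {p}

/-- `p`-adic convergence of a sequence in `K`: for each `N`, eventually `u n - x ∈ p^N W`. -/
def HasPadicLimit (u : ℕ → K p) (x : K p) : Prop :=
  ∀ N : ℕ, ∀ᶠ n in atTop, ∃ w : W p, u n - x = (p : K p) ^ N * algebraMap (W p) (K p) w

open Classical in
/-- The `p`-adic limit of a sequence in `K` (with value `0` if there is none). -/
def padicLimit (u : ℕ → K p) : K p :=
  if h : ∃ x, HasPadicLimit u x then h.choose else 0

/-- `|z - 1| < 1` for `z ∈ K`, that is, `z ∈ 1 + pW`. -/
def IsPrincipalUnit (z : K p) : Prop :=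
  ∃ w : W p, z = 1 + (p : K p) * algebraMap (W p) (K p) w

/-- The series `-∑_{n ≥ 1} (1 - z)^n / n`. -/
def logSeries (z : K p) : K p :=
  padicLimit fun m => -∑ n ∈ Finset.Icc 1 m, (1 - z) ^ n / (n : K p)

open Classical in
/-- The Iwasawa logarithm on `K` (with value `0` at `0`). It is given by the series on `1 + pW`.
Any `z ≠ 0` has a power of the form `z ^ N = p ^ M * y` with `N ≥ 1` and `y ∈ 1 + pW`, and then
`log z = (log y) / N`, because `log` is a homomorphism with `log p = 0`. -/
def iwasawaLog (z : K p) : K p :=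
  if IsPrincipalUnit z then logSeries z
  else if h : ∃ t : ℕ × ℤ × K p, 0 < t.1 ∧ IsPrincipalUnit t.2.2 ∧
      z ^ t.1 = (p : K p) ^ t.2.1 * t.2.2 then
    logSeries h.choose.2.2 / (h.choose.1 : K p)
  else 0

variable (p) in
/-- The `p`-adic Euler constant `γ_p = lim_s p^{-s} ∑_{0 ≤ j < p^s, p ∤ j} log j`. -/
def eulerConst : K p :=
  padicLimit fun s => 1 / (p : K p) ^ s *
    ∑ j ∈ (Finset.range (p ^ s)).filter (fun j => ¬ p ∣ j), iwasawaLog (j : K p)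

/-- The `p`-adic digamma function `ψ_p(z) = -γ_p + ψ̃_p(z)`. -/
def digamma (z : ℤ_[p]) : K p := -eulerConst p + qpToK p (psiTilde z)

/-- The Frobenius `σ` with `σ(t) = c t^p`, that is, `(∑ a_i t^i)^σ = ∑ a_i^F c^i t^{ip}`, where
`F` is the Frobenius of `K` induced by that of `W`. -/
def sigma (c : W p) (f : (K p)⟦X⟧) : (K p)⟦X⟧ :=
  PowerSeries.mk fun m =>
    if p ∣ m then
      WittVector.FractionRing.frobenius p (AlgebraicClosure (ZMod p)) (coeff (m / p) f) *
        algebraMap (W p) (K p) c ^ (m / p)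
    else 0

/-- The operator `∫_0^t (-) dt/t` sending `∑ a_n t^n` (with `a_0 = 0`) to `∑ (a_n / n) t^n`. -/
def logIntegral (f : (K p)⟦X⟧) : (K p)⟦X⟧ :=
  PowerSeries.mk fun n => coeff n f / (n : K p)

/-- `F_{a,b}(t)` as a power series over `K`. -/
def hypF {r : ℕ} (a : Fin (r + 1) → ℤ_[p]) (b : Fin r → ℤ_[p]) : (K p)⟦X⟧ :=
  PowerSeries.map (qpToK p) (hypSeries a b)

/-- `F^{(i)}_{a,b}(t)`, the series with parameters `a_j^{(i)}`, `b_j^{(i)}`. -/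
def hypFIter (i : ℕ) {r : ℕ} (a : Fin (r + 1) → ℤ_[p]) (b : Fin r → ℤ_[p]) : (K p)⟦X⟧ :=
  hypF (fun k => dworkIter i (a k)) (fun j => dworkIter i (b j))

/-- The power series `G_{a,b}(t)`. -/
def hypG (c : W p) {r : ℕ} (a : Fin (r + 1) → ℤ_[p]) (b : Fin r → ℤ_[p]) : (K p)⟦X⟧ :=
  PowerSeries.C (∑ i, digamma (a i) - ∑ j, digamma (b j) + eulerConst p
      - (p : K p)⁻¹ * iwasawaLog (algebraMap (W p) (K p) c))
    + logIntegral (hypF a b - sigma c (hypFIter 1 a b))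

/-- The generalized `p`-adic hypergeometric function of logarithmic type `G_{a,b}(t)/F_{a,b}(t)`.
The denominator has constant term `1`. -/
def logTypeHyp (c : W p) {r : ℕ} (a : Fin (r + 1) → ℤ_[p]) (b : Fin r → ℤ_[p]) : (K p)⟦X⟧ :=
  hypG c a b * (hypF a b)⁻¹

/-- The truncation `[f]_{<m}`, regarded as a power series. -/
def truncLT (m : ℕ) (f : (K p)⟦X⟧) : (K p)⟦X⟧ := (PowerSeries.trunc m f : Polynomial (K p))

/-- `f ∈ W[[t]]`. -/
def IsIntegralSeries (f : (K p)⟦X⟧) : Prop :=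
  ∃ h : (W p)⟦X⟧, f = PowerSeries.map (algebraMap (W p) (K p)) h

/-- `f ≡ g mod p^m W[[t]]`. -/
def CongrModPow (m : ℕ) (f g : (K p)⟦X⟧) : Prop :=
  ∃ h : (W p)⟦X⟧,
    f - g = PowerSeries.C ((p : K p) ^ m) * PowerSeries.map (algebraMap (W p) (K p)) h

end Witt

end LogHyp

end


/-!
Write `A_k` and `A'_k` for the coefficients of `F` and `F^(1)`, so that `G = ∑ α_k A_k t^k`. If
`p ∤ k` then `α_k = 1 / k`. If `k = p m` then `α_k = (1 - f m) / (p m)` with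
`f m = c^m A'_m / A_{pm}`, and the constant term `α_0 = θ₀` of `G` is the value at `m = 0`: the
quotient `A'_m / A_{pm}` is a ratio of products of units along arithmetic progressions, and up to
a factor `2` the function `f` agrees to second order with `m ↦ exp (-p m θ₀)`. Hence
`k ≡ k' mod p^n` implies `2 α_k ≡ 2 α_{k'} mod p^n`.

Dwork's congruences say that modulo `p^(s+1)` the series `∑_j A_{l + j p^d} t^j` and the `d`-th
Dwork prime of `F` have the same quotients by their truncations at degree `p^s`. Replacing `α_k`
successively by its values at the residues of `k` modulo `p^n, p^(n-1), …, 1`, each replacement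
costs such a congruence times a difference of values of `α`, and everything adds up to
`2 (G [F]_{<p^n} - F [G]_{<p^n}) ≡ 0 mod p^n`. The series `F` and `[F]_{<p^n}` are units, and so
is `2` when `p` is odd.
-/

noncomputable section

namespace LogHyp

section DworkChain

@[to_additive]
theorem prod_range_eq_prod_blocks {M : Type*} [CommMonoid M] (a b : ℕ) (f : ℕ → M) :
    ∏ j ∈ Finset.range (a * b), f j =
      ∏ i ∈ Finset.range b, ∏ j ∈ Finset.range a, f (j + i * a) := by
  induction b with
  | zero => simp
  | succ b ih =>
    rw [Nat.mul_succ, Finset.prod_range_add, ih, Finset.prod_range_succ]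
    simp only [mul_comm a b, add_comm (b * a)]

theorem add_mul_pow_lt {p d s l u : ℕ} (hl : l < p ^ d) (hu : u < p ^ s) :
    l + u * p ^ d < p ^ (d + s) :=
  calc l + u * p ^ d < (u + 1) * p ^ d := by lia
    _ ≤ p ^ s * p ^ d := Nat.mul_le_mul_right _ hu
    _ = p ^ (d + s) := by ring

theorem exists_eq_add_mul_of_lt_pow_succ {p d l : ℕ} (hl : l < p ^ (d + 1)) :
    ∃ l₀ < p, ∃ l₁ < p ^ d, l = l₀ + l₁ * p := by
  have hp : 0 < p := Nat.pos_of_ne_zero fun h => by simp [h] at hl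
  refine ⟨l % p, Nat.mod_lt _ hp, l / p, Nat.div_lt_of_lt_mul (by rwa [pow_succ'] at hl), ?_⟩
  rw [mul_comm, Nat.mod_add_div]

variable {k : Type*} [NormedField k]

/-- The extension of a sequence by zero to negative indices. -/
def extendByZero (X : ℕ → k) (z : ℤ) : k := if 0 ≤ z then X z.toNat else 0

theorem extendByZero_natCast (X : ℕ → k) (n : ℕ) : extendByZero X n = X n := by
  simp [extendByZero]

theorem extendByZero_of_neg (X : ℕ → k) {z : ℤ} (hz : z < 0) : extendByZero X z = 0 := by
  simp [extendByZero, not_le.2 hz]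

theorem norm_extendByZero_le {X : ℕ → k} {c : ℝ} (hX : ∀ n, ‖X n‖ ≤ c) (z : ℤ) :
    ‖extendByZero X z‖ ≤ c := by
  unfold extendByZero
  split_ifs
  · exact hX _
  · simpa using (norm_nonneg _).trans (hX 0)

/-- The `j`-th term `X_{N-j} Y_j - Y_{N-j} X_j` of the antisymmetric convolution of two sequences
at `N`; Dwork's congruences bound the sums of these terms over `p`-adic blocks of indices `j`. -/
def antisymmTerm (X Y : ℕ → k) (N : ℤ) (j : ℕ) : k :=
  extendByZero X (N - j) * Y j - extendByZero Y (N - j) * X j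

/-- The part of the antisymmetric convolution of `X` and `Y` at `N` with index in the block
`m p^s ≤ j < (m + 1) p^s`. -/
def blockSum (p : ℕ) (X Y : ℕ → k) (N : ℤ) (s m : ℕ) : k :=
  ∑ j ∈ Finset.range (p ^ s), antisymmTerm X Y N (j + m * p ^ s)

theorem antisymmTerm_of_lt (X Y : ℕ → k) {N : ℤ} {j : ℕ} (h : N < j) :
    antisymmTerm X Y N j = 0 := by
  simp [antisymmTerm, extendByZero_of_neg _ (sub_neg.2 h)]

theorem sum_antisymmTerm_eq_zero (X Y : ℕ → k) (N : ℕ) :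
    ∑ j ∈ Finset.range (N + 1), antisymmTerm X Y N j = 0 := by
  simp only [antisymmTerm]
  rw [Finset.sum_sub_distrib, sub_eq_zero, ← Finset.sum_range_reflect]
  refine Finset.sum_congr rfl fun j hj => ?_
  have hj' : j ≤ N := Finset.mem_range_succ_iff.1 hj
  rw [show N + 1 - 1 - j = N - j by lia, show (N : ℤ) - ((N - j : ℕ) : ℤ) = (j : ℕ) by lia,
    show (N : ℤ) - (j : ℤ) = ((N - j : ℕ) : ℤ) by lia, extendByZero_natCast, extendByZero_natCast,
    mul_comm]

theorem sum_antisymmTerm_eq_zero_of_lt (X Y : ℕ → k) {N : ℤ} {M : ℕ} (hM : N < M) :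
    ∑ j ∈ Finset.range M, antisymmTerm X Y N j = 0 := by
  rcases lt_or_ge N 0 with hN | hN
  · exact Finset.sum_eq_zero fun j _ => antisymmTerm_of_lt X Y (by lia)
  · lift N to ℕ using hN
    obtain ⟨d, rfl⟩ := Nat.exists_eq_add_of_le (show N + 1 ≤ M by lia)
    rw [Finset.sum_range_add, sum_antisymmTerm_eq_zero, zero_add]
    exact Finset.sum_eq_zero fun j _ => antisymmTerm_of_lt X Y (by lia)

theorem blockSum_succ (p : ℕ) (X Y : ℕ → k) (N : ℤ) (s m : ℕ) :
    blockSum p X Y N (s + 1) m = ∑ i ∈ Finset.range p, blockSum p X Y N s (i + m * p) := by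
  unfold blockSum
  rw [pow_succ, sum_range_eq_sum_blocks]
  refine Finset.sum_congr rfl fun i _ => Finset.sum_congr rfl fun j _ => ?_
  rw [show j + i * p ^ s + m * (p ^ s * p) = j + (i + m * p) * p ^ s by ring]

theorem blockSum_of_neg (p : ℕ) (X Y : ℕ → k) {N : ℤ} (hN : N < 0) (s m : ℕ) :
    blockSum p X Y N s m = 0 :=
  Finset.sum_eq_zero fun j _ => antisymmTerm_of_lt X Y (by lia)

theorem sum_blockSum_eq_zero (p : ℕ) (X Y : ℕ → k) {N : ℤ} {s M : ℕ}
    (hM : N < (p ^ s * M : ℕ)) : ∑ m ∈ Finset.range M, blockSum p X Y N s m = 0 := by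
  have h := sum_antisymmTerm_eq_zero_of_lt X Y hM
  rwa [sum_range_eq_sum_blocks] at h

/-- A chain of sequences `A 0, A 1, …`, with `A (r + 1)` in the role of the Dwork prime of `A r`,
satisfying Dwork's congruences with modulus `ε` (which is `p⁻¹` in the application). The gauge
`G r n`, written `g_r(n)` by Dwork, bounds `A r n` and measures how divisible the congruences
at `n` have to be. -/
structure DworkChain (p : ℕ) (ε : ℝ) (A : ℕ → ℕ → k) (G : ℕ → ℕ → ℝ) : Prop where
  pos : 0 < p
  modulus_nonneg : 0 ≤ ε
  modulus_le_one : ε ≤ 1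
  zero : ∀ r, A r 0 = 1
  ne_zero : ∀ r n, A r n ≠ 0
  norm_le : ∀ r n, ‖A r n‖ ≤ G r n
  gauge_le_one : ∀ r n, G r n ≤ 1
  gauge_le_succ : ∀ r l u, l < p → G r (l + u * p) ≤ G (r + 1) u
  congr : ∀ r s l u n, l < p → u < p ^ s →
    G r (l + u * p) * ‖A r (l + u * p + n * p ^ (s + 1)) / A r (l + u * p)
      - A (r + 1) (u + n * p ^ s) / A (r + 1) u‖ ≤ ε ^ (s + 1) * G (r + s + 1) n

/-- The sequence `B` satisfies the same congruences as `A 0` relative to the chain `A`. -/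
def DworkCompatible (p : ℕ) (ε : ℝ) (A : ℕ → ℕ → k) (G : ℕ → ℕ → ℝ) (B : ℕ → k) : Prop :=
  ∀ s u n, u < p ^ s →
    ‖B (u + n * p ^ s) - B u * (A 0 (u + n * p ^ s) / A 0 u)‖ ≤ ε ^ (s + 1) * G s n

/-- The sum of the blocks of length `p^t` inside the block of length `p^(t + d)` at `0`, twisted
by ratios of the coefficients of `A t`. It interpolates between the block sum of length `p^d`
translated by `m p^d` (for `t = 0`, up to a small error) and `A d m` times the block sum at `0`
(for `d = 0`). -/
def twistedBlockSum (p : ℕ) (A : ℕ → ℕ → k) (B : ℕ → k) (N : ℤ) (t d m : ℕ) : k :=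
  ∑ j ∈ Finset.range (p ^ d), A t (j + m * p ^ d) / A t j * blockSum p B (A 0) N t j

variable {p : ℕ} {ε : ℝ} {A : ℕ → ℕ → k} {G : ℕ → ℕ → ℝ} {B : ℕ → k}

namespace DworkChain

theorem gauge_nonneg (h : DworkChain p ε A G) (r n : ℕ) : 0 ≤ G r n :=
  (norm_nonneg _).trans (h.norm_le r n)

theorem norm_le_one (h : DworkChain p ε A G) (r n : ℕ) : ‖A r n‖ ≤ 1 :=
  (h.norm_le r n).trans (h.gauge_le_one r n)

theorem pow_mul_gauge_nonneg (h : DworkChain p ε A G) (t r n : ℕ) : 0 ≤ ε ^ t * G r n :=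
  mul_nonneg (pow_nonneg h.modulus_nonneg t) (h.gauge_nonneg r n)

theorem pow_mul_gauge_le_pow (h : DworkChain p ε A G) (t r n : ℕ) : ε ^ t * G r n ≤ ε ^ t :=
  mul_le_of_le_one_right (pow_nonneg h.modulus_nonneg t) (h.gauge_le_one r n)

theorem shift (h : DworkChain p ε A G) (d : ℕ) :
    DworkChain p ε (fun r => A (d + r)) (fun r => G (d + r)) where
  pos := h.pos
  modulus_nonneg := h.modulus_nonneg
  modulus_le_one := h.modulus_le_one
  zero r := h.zero _
  ne_zero r := h.ne_zero _
  norm_le r := h.norm_le _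
  gauge_le_one r := h.gauge_le_one _
  gauge_le_succ r := h.gauge_le_succ _
  congr r s l u n hl hu := by
    simpa only [add_assoc] using h.congr (d + r) s l u n hl hu

theorem antisymmTerm_sub_mul_eq (h : DworkChain p ε A G) (B : ℕ → k) (N : ℤ) (s m j : ℕ) :
    antisymmTerm B (A 0) (N + (m * p ^ s : ℕ)) (j + m * p ^ s)
        - A 0 (j + m * p ^ s) / A 0 j * antisymmTerm B (A 0) N j =
      -(extendByZero (A 0) (N - j) *
        (B (j + m * p ^ s) - B j * (A 0 (j + m * p ^ s) / A 0 j))) := by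
  have h0 := h.ne_zero 0 j
  rw [antisymmTerm, antisymmTerm,
    show N + ((m * p ^ s : ℕ) : ℤ) - ((j + m * p ^ s : ℕ) : ℤ) = N - (j : ℕ) by push_cast; ring]
  field_simp
  ring

variable [IsUltrametricDist k]

open IsUltrametricDist

theorem norm_blockSum_sub_twistedBlockSum_le (h : DworkChain p ε A G)
    (hB : DworkCompatible p ε A G B) (N : ℤ) (s m : ℕ) :
    ‖blockSum p B (A 0) (N + (m * p ^ s : ℕ)) s m - twistedBlockSum p A B N 0 s m‖ ≤
      ε ^ (s + 1) * G s m := by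
  rw [blockSum, twistedBlockSum, ← Finset.sum_sub_distrib]
  refine norm_sum_le_of_forall_le_of_nonneg (h.pow_mul_gauge_nonneg _ _ _) fun j hj => ?_
  have hblock : blockSum p B (A 0) N 0 j = antisymmTerm B (A 0) N j := by simp [blockSum]
  rw [hblock, h.antisymmTerm_sub_mul_eq, norm_neg, norm_mul]
  exact (mul_le_of_le_one_left (norm_nonneg _) (norm_extendByZero_le (h.norm_le_one 0) _)).trans
    (hB s j m (Finset.mem_range.1 hj))

theorem norm_twistedBlockSum_sub_succ_le (h : DworkChain p ε A G) {N : ℤ} {t : ℕ}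
    (hblock : ∀ j, ‖blockSum p B (A 0) N t j‖ ≤ ε ^ (t + 1) * G t j) (d m : ℕ) :
    ‖twistedBlockSum p A B N t (d + 1) m - twistedBlockSum p A B N (t + 1) d m‖ ≤
      ε ^ (t + d + 2) * G (t + d + 1) m := by
  have hnonneg := h.pow_mul_gauge_nonneg (t + d + 2) (t + d + 1) m
  unfold twistedBlockSum
  rw [pow_succ, mul_comm (p ^ d) p, sum_range_eq_sum_blocks, ← Finset.sum_sub_distrib]
  refine norm_sum_le_of_forall_le_of_nonneg hnonneg fun u hu => ?_
  rw [blockSum_succ, Finset.mul_sum, ← Finset.sum_sub_distrib]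
  refine norm_sum_le_of_forall_le_of_nonneg hnonneg fun i hi => ?_
  rw [← sub_mul, norm_mul, show m * (p * p ^ d) = m * p ^ (d + 1) by ring]
  calc _ ≤ _ * (ε ^ (t + 1) * G t (i + u * p)) :=
        mul_le_mul_of_nonneg_left (hblock _) (norm_nonneg _)
    _ = ε ^ (t + 1) * (G t (i + u * p) * ‖A t (i + u * p + m * p ^ (d + 1)) / A t (i + u * p)
        - A (t + 1) (u + m * p ^ d) / A (t + 1) u‖) := by ring
    _ ≤ ε ^ (t + 1) * (ε ^ (d + 1) * G (t + d + 1) m) :=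
        mul_le_mul_of_nonneg_left
          (h.congr t d i u m (Finset.mem_range.1 hi) (Finset.mem_range.1 hu))
          (pow_nonneg h.modulus_nonneg _)
    _ = _ := by rw [← mul_assoc, ← pow_add]; congr 2; lia

theorem norm_blockSum_sub_twistedBlockSum_le_of_lt (h : DworkChain p ε A G)
    (hB : DworkCompatible p ε A G B) {s : ℕ}
    (ih : ∀ t < s, ∀ N m, ‖blockSum p B (A 0) N t m‖ ≤ ε ^ (t + 1) * G t m) (N : ℤ) (m : ℕ)
    (t d : ℕ) (htd : t + d = s) :
    ‖blockSum p B (A 0) (N + (m * p ^ s : ℕ)) s m - twistedBlockSum p A B N t d m‖ ≤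
      ε ^ (s + 1) * G s m := by
  induction t generalizing d with
  | zero =>
    obtain rfl : d = s := by lia
    exact h.norm_blockSum_sub_twistedBlockSum_le hB N d m
  | succ t iht =>
    have hstep := h.norm_twistedBlockSum_sub_succ_le (ih t (by lia) N) d m
    rw [show t + d + 2 = s + 1 by lia, show t + d + 1 = s by lia] at hstep
    rw [← sub_add_sub_cancel _ (twistedBlockSum p A B N t (d + 1) m)]
    exact (norm_add_le_max _ _).trans (max_le (iht (d + 1) (by lia)) hstep)

theorem norm_blockSum_zero_le (h : DworkChain p ε A G) {s : ℕ}
    (hstep : ∀ N m, ‖blockSum p B (A 0) (N + (m * p ^ s : ℕ)) s m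
      - A s m * blockSum p B (A 0) N s 0‖ ≤ ε ^ (s + 1) * G s m) (N : ℤ) :
    ‖blockSum p B (A 0) N s 0‖ ≤ ε ^ (s + 1) := by
  have hε := pow_nonneg h.modulus_nonneg (s + 1)
  have hs : 0 < p ^ s := pow_pos h.pos s
  obtain ⟨M, hM⟩ : ∃ M : ℕ, N < M := ⟨N.toNat + 1, by lia⟩
  induction M generalizing N with
  | zero => rwa [blockSum_of_neg p _ _ (by simpa using hM), norm_zero]
  | succ M ihM =>
    -- The blocks at `N` add up to zero, so the first one is bounded by the others, and those are
    -- multiples of first blocks at smaller `N` up to a small error.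
    have hsum := sum_blockSum_eq_zero p B (A 0) (N := N) (s := s) (M := M + 1) (hM.trans_le (by
      exact_mod_cast Nat.le_mul_of_pos_left _ hs))
    rw [Finset.sum_range_succ', add_comm] at hsum
    rw [eq_neg_of_add_eq_zero_left hsum, norm_neg]
    refine norm_sum_le_of_forall_le_of_nonneg hε fun i _ => ?_
    have hshift := hstep (N - ((i + 1) * p ^ s : ℕ)) (i + 1)
    have hpos : 1 ≤ (i + 1) * p ^ s := Nat.mul_pos i.succ_pos hs
    have hfirst := ihM (N - ((i + 1) * p ^ s : ℕ)) (by lia)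
    rw [sub_add_cancel] at hshift
    rw [← sub_add_cancel (blockSum p B (A 0) N s (i + 1)) _]
    refine (norm_add_le_max _ _).trans (max_le (hshift.trans (h.pow_mul_gauge_le_pow _ _ _)) ?_)
    rw [norm_mul]
    exact (mul_le_of_le_one_left (norm_nonneg _) (h.norm_le_one _ _)).trans hfirst

theorem norm_blockSum_le (h : DworkChain p ε A G) (hB : DworkCompatible p ε A G B)
    (s : ℕ) (N : ℤ) (m : ℕ) : ‖blockSum p B (A 0) N s m‖ ≤ ε ^ (s + 1) * G s m := by
  induction s using Nat.strong_induction_on generalizing N m with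
  | _ s ih =>
  have hstep (N : ℤ) (m : ℕ) : ‖blockSum p B (A 0) (N + (m * p ^ s : ℕ)) s m
      - A s m * blockSum p B (A 0) N s 0‖ ≤ ε ^ (s + 1) * G s m := by
    simpa [twistedBlockSum, h.zero] using
      h.norm_blockSum_sub_twistedBlockSum_le_of_lt hB ih N m s 0 (add_zero s)
  have hshift := hstep (N - (m * p ^ s : ℕ)) m
  rw [sub_add_cancel] at hshift
  rw [← sub_add_cancel (blockSum p B (A 0) N s m) _]
  refine (norm_add_le_max _ _).trans (max_le hshift ?_)
  rw [norm_mul, mul_comm]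
  exact mul_le_mul (h.norm_blockSum_zero_le hstep _) (h.norm_le _ _) (norm_nonneg _)
    (pow_nonneg h.modulus_nonneg _)

theorem congr_iterate (h : DworkChain p ε A G) {d l s u : ℕ} (r n : ℕ) (hl : l < p ^ d)
    (hu : u < p ^ s) :
    G r (l + u * p ^ d) * ‖A r (l + (u + n * p ^ s) * p ^ d) / A r (l + u * p ^ d)
      - A (r + d) (u + n * p ^ s) / A (r + d) u‖ ≤ ε ^ (s + 1) * G (r + d + s) n := by
  induction d generalizing r l with
  | zero =>
    obtain rfl : l = 0 := by simpa using hl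
    simpa using h.pow_mul_gauge_nonneg (s + 1) (r + s) n
  | succ d ih =>
    obtain ⟨l₀, hl₀, l₁, hl₁, rfl⟩ := exists_eq_add_mul_of_lt_pow_succ hl
    have hfirst := h.congr r (d + s) l₀ (l₁ + u * p ^ d) n hl₀ (add_mul_pow_lt hl₁ hu)
    have hrest := ih (r + 1) hl₁
    rw [show l₁ + u * p ^ d + n * p ^ (d + s) = l₁ + (u + n * p ^ s) * p ^ d by ring,
      show r + (d + s) + 1 = r + (d + 1) + s by ring] at hfirst
    rw [show r + 1 + d = r + (d + 1) by ring] at hrest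
    rw [show l₀ + l₁ * p + u * p ^ (d + 1) = l₀ + (l₁ + u * p ^ d) * p by ring,
      show l₀ + l₁ * p + (u + n * p ^ s) * p ^ (d + 1)
        = l₀ + (l₁ + u * p ^ d) * p + n * p ^ (d + s + 1) by ring,
      ← sub_add_sub_cancel _ (A (r + 1) (l₁ + (u + n * p ^ s) * p ^ d) /
        A (r + 1) (l₁ + u * p ^ d))]
    refine (mul_le_mul_of_nonneg_left (norm_add_le_max _ _) (h.gauge_nonneg _ _)).trans ?_
    rw [mul_max_of_nonneg _ _ (h.gauge_nonneg _ _)]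
    refine max_le (hfirst.trans (mul_le_mul_of_nonneg_right ?_ (h.gauge_nonneg _ _)))
      ((mul_le_mul_of_nonneg_right (h.gauge_le_succ _ _ _ hl₀) (norm_nonneg _)).trans hrest)
    exact pow_le_pow_of_le_one h.modulus_nonneg h.modulus_le_one (by lia)

theorem dworkCompatible_subsequence (h : DworkChain p ε A G) {d l : ℕ} (hl : l < p ^ d) :
    DworkCompatible p ε (fun r => A (d + r)) (fun r => G (d + r))
      (fun j => A 0 (l + j * p ^ d)) := by
  intro s u n hu
  have hcongr := h.congr_iterate 0 n hl hu
  rw [zero_add] at hcongr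
  have hfactor : A 0 (l + (u + n * p ^ s) * p ^ d)
      - A 0 (l + u * p ^ d) * (A d (u + n * p ^ s) / A d u)
      = A 0 (l + u * p ^ d) * (A 0 (l + (u + n * p ^ s) * p ^ d) / A 0 (l + u * p ^ d)
        - A d (u + n * p ^ s) / A d u) := by
    rw [mul_sub, mul_div_cancel₀ _ (h.ne_zero 0 _)]
  simp only [add_zero, hfactor, norm_mul]
  exact (mul_le_mul_of_nonneg_right (h.norm_le _ _) (norm_nonneg _)).trans hcongr

theorem norm_blockSum_subsequence_le (h : DworkChain p ε A G) {d l : ℕ} (hl : l < p ^ d)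
    (s : ℕ) (N : ℤ) :
    ‖blockSum p (fun j => A 0 (l + j * p ^ d)) (A d) N s 0‖ ≤ ε ^ (s + 1) :=
  ((h.shift d).norm_blockSum_le (h.dworkCompatible_subsequence hl) s N 0).trans
    (h.pow_mul_gauge_le_pow _ _ _)

end DworkChain

end DworkChain

section UnitProducts

theorem dvd_mul_prod_sub_prod {R ι : Type*} [CommRing R] (c d : R) (s : Finset ι) (f g : ι → R)
    (h : ∀ i ∈ s, d ∣ c * (f i - g i)) : d ∣ c * (∏ i ∈ s, f i - ∏ i ∈ s, g i) := by
  classical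
  induction s using Finset.induction_on with
  | empty => simp
  | insert a s ha ih =>
    simp only [Finset.mem_insert, forall_eq_or_imp] at h
    rw [Finset.prod_insert ha, Finset.prod_insert ha]
    convert dvd_add (h.1.mul_right (∏ i ∈ s, f i)) ((ih h.2).mul_left (g a)) using 1
    ring

theorem dvd_prod_sub_prod {R ι : Type*} [CommRing R] (d : R) (s : Finset ι) (f g : ι → R)
    (h : ∀ i ∈ s, d ∣ f i - g i) : d ∣ ∏ i ∈ s, f i - ∏ i ∈ s, g i := by
  simpa using dvd_mul_prod_sub_prod 1 d s f g (by simpa using h)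

theorem sq_dvd_prod_one_add_sub {R ι : Type*} [CommRing R] (d : R) (s : Finset ι) (y : ι → R) :
    d ^ 2 ∣ ∏ i ∈ s, (1 + d * y i) - (1 + d * ∑ i ∈ s, y i) := by
  classical
  induction s using Finset.induction_on with
  | empty => simp
  | insert a s ha ih =>
    rw [Finset.prod_insert ha, Finset.sum_insert ha]
    obtain ⟨c, hc⟩ := ih
    rw [sub_eq_iff_eq_add] at hc
    rw [hc]
    exact ⟨c * (1 + d * y a) + y a * ∑ i ∈ s, y i, by ring⟩

variable {p : ℕ} [Fact p.Prime]

theorem isUnit_of_not_dvd {x : ℤ_[p]} (h : ¬ (p : ℤ_[p]) ∣ x) : IsUnit x := by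
  by_contra hx
  exact h ((PadicInt.norm_lt_one_iff_dvd x).1 (PadicInt.not_isUnit_iff.1 hx))

theorem exists_nat_dvd_sub {d : ℤ_[p]} (hd : d ≠ 0) (x : ℤ_[p]) : ∃ n : ℕ, d ∣ x - n := by
  have h := PadicInt.appr_spec d.valuation x
  rw [Ideal.mem_span_singleton] at h
  refine ⟨_, dvd_trans ?_ h⟩
  conv_lhs => rw [PadicInt.unitCoeff_spec hd]
  exact Units.mul_left_dvd.2 dvd_rfl

theorem norm_le_inv_pow_iff (x : ℤ_[p]) (n : ℕ) :
    ‖(x : ℚ_[p])‖ ≤ (p : ℝ)⁻¹ ^ n ↔ (p : ℤ_[p]) ^ n ∣ x := by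
  rw [← Ideal.mem_span_singleton, ← PadicInt.norm_le_pow_iff_mem_span_pow, PadicInt.norm_def,
    zpow_neg, zpow_natCast, inv_pow]

theorem coe_prod {ι : Type*} (s : Finset ι) (f : ι → ℤ_[p]) :
    ((∏ i ∈ s, f i : ℤ_[p]) : ℚ_[p]) = ∏ i ∈ s, (f i : ℚ_[p]) :=
  map_prod (PadicInt.Coe.ringHom (p := p)) f s

open Classical in
/-- The prime-to-`p` part of the factor `x`: it is `x` for units and `1` otherwise. -/
def unitPart (x : ℤ_[p]) : ℤ_[p] := if (p : ℤ_[p]) ∣ x then 1 else x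

open Classical in
/-- The complementary part: `x` if `p ∣ x` and `1` otherwise. -/
def multPart (x : ℤ_[p]) : ℤ_[p] := if (p : ℤ_[p]) ∣ x then x else 1

open Classical in
/-- The inverse of `x` for units `x`, and `0` otherwise. -/
def unitInv (x : ℤ_[p]) : ℤ_[p] := if (p : ℤ_[p]) ∣ x then 0 else x.inv

theorem unitPart_mul_multPart (x : ℤ_[p]) : unitPart x * multPart x = x := by
  unfold unitPart multPart; split_ifs <;> simp

theorem isUnit_unitPart (x : ℤ_[p]) : IsUnit (unitPart x) := by
  unfold unitPart
  split_ifs with h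
  · exact isUnit_one
  · exact isUnit_of_not_dvd h

theorem mul_unitInv {x : ℤ_[p]} (h : ¬ (p : ℤ_[p]) ∣ x) : x * unitInv x = 1 := by
  rw [unitInv, if_neg h]
  exact PadicInt.mul_inv (PadicInt.isUnit_iff.1 (isUnit_of_not_dvd h))

theorem unitInv_neg (x : ℤ_[p]) : unitInv (-x) = -unitInv x := by
  by_cases h : (p : ℤ_[p]) ∣ x
  · rw [unitInv, unitInv, if_pos h, if_pos (dvd_neg.2 h), neg_zero]
  · have h' : ¬ (p : ℤ_[p]) ∣ -x := by rwa [dvd_neg]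
    refine (isUnit_of_not_dvd h').mul_left_cancel ?_
    rw [mul_unitInv h', neg_mul_neg, mul_unitInv h]

theorem unitPart_congr {d x y : ℤ_[p]} (hd : (p : ℤ_[p]) ∣ d) (h : d ∣ x - y) :
    d ∣ unitPart x - unitPart y := by
  unfold unitPart
  rw [dvd_iff_dvd_of_dvd_sub (hd.trans h)]
  split_ifs <;> simp [h]

theorem unitInv_congr {d x y : ℤ_[p]} (hd : (p : ℤ_[p]) ∣ d) (h : d ∣ x - y) :
    d ∣ unitInv x - unitInv y := by
  have hxy := dvd_iff_dvd_of_dvd_sub (hd.trans h)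
  by_cases hy : (p : ℤ_[p]) ∣ y
  · rw [unitInv, unitInv, if_pos hy, if_pos (hxy.2 hy)]; simp
  · have hx := fun hx => hy (hxy.1 hx)
    have e : unitInv x - unitInv y = -(x - y) * (unitInv x * unitInv y) := by
      linear_combination unitInv y * mul_unitInv hx - unitInv x * mul_unitInv hy
    rw [e]
    exact (dvd_neg.2 h).mul_right _

theorem unitPart_add {d : ℤ_[p]} (hd : (p : ℤ_[p]) ∣ d) (x : ℤ_[p]) :
    unitPart (x + d) = unitPart x * (1 + d * unitInv x) := by
  have hxy : (p : ℤ_[p]) ∣ x + d ↔ (p : ℤ_[p]) ∣ x := dvd_add_left hd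
  by_cases hx : (p : ℤ_[p]) ∣ x
  · rw [unitPart, unitPart, unitInv, if_pos hx, if_pos hx, if_pos (hxy.2 hx)]; simp
  · rw [unitPart, unitPart, if_neg hx, if_neg (fun h => hx (hxy.1 h))]
    linear_combination (-d) * mul_unitInv hx

/-- The product of the units in `{α, α + 1, …, α + M - 1}`. -/
def unitProd (α : ℤ_[p]) (M : ℕ) : ℤ_[p] := ∏ i ∈ Finset.range M, unitPart (α + (i : ℤ_[p]))

/-- The sum of the inverses of the units in `{α, α + 1, …, α + M - 1}`. -/
def unitHarmonic (α : ℤ_[p]) (M : ℕ) : ℤ_[p] := ∑ i ∈ Finset.range M, unitInv (α + (i : ℤ_[p]))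

theorem isUnit_unitProd (α : ℤ_[p]) (M : ℕ) : IsUnit (unitProd α M) := by
  rw [unitProd, IsUnit.prod_iff]
  exact fun i _ => isUnit_unitPart _

theorem unitProd_add (α : ℤ_[p]) (M N : ℕ) :
    unitProd α (M + N) = unitProd α M * unitProd (α + (M : ℤ_[p])) N := by
  simp only [unitProd, Finset.prod_range_add, Nat.cast_add, add_assoc]

theorem unitHarmonic_add (α : ℤ_[p]) (M N : ℕ) :
    unitHarmonic α (M + N) = unitHarmonic α M + unitHarmonic (α + (M : ℤ_[p])) N := by
  simp only [unitHarmonic, Finset.sum_range_add, Nat.cast_add, add_assoc]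

theorem unitProd_congr_left {d α β : ℤ_[p]} (hd : (p : ℤ_[p]) ∣ d) (h : d ∣ α - β) (M : ℕ) :
    d ∣ unitProd α M - unitProd β M :=
  dvd_prod_sub_prod d _ _ _ fun i _ => unitPart_congr hd (by simpa using h)

theorem unitHarmonic_congr_left {d α β : ℤ_[p]} (hd : (p : ℤ_[p]) ∣ d) (h : d ∣ α - β) (M : ℕ) :
    d ∣ unitHarmonic α M - unitHarmonic β M := by
  rw [unitHarmonic, unitHarmonic, ← Finset.sum_sub_distrib]
  exact Finset.dvd_sum fun i _ => unitInv_congr hd (by simpa using h)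

theorem dvd_unitProd_shift {d : ℤ_[p]} (hd : (p : ℤ_[p]) ∣ d) {M : ℕ} (hM : d ∣ M)
    (α : ℤ_[p]) (n : ℕ) : d ∣ unitProd (α + (n : ℤ_[p])) M - unitProd α M := by
  have hsplit := unitProd_add α n M
  rw [add_comm n M, unitProd_add α M n] at hsplit
  refine (isUnit_unitProd α n).dvd_mul_left.1 ?_
  have hshift : d ∣ unitProd (α + (M : ℤ_[p])) n - unitProd α n :=
    unitProd_congr_left hd (by simpa using hM) n
  convert hshift.mul_left (unitProd α M) using 1
  linear_combination -hsplit

theorem dvd_unitHarmonic_shift {d : ℤ_[p]} (hd : (p : ℤ_[p]) ∣ d) {M : ℕ} (hM : d ∣ M)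
    (α : ℤ_[p]) (n : ℕ) : d ∣ unitHarmonic (α + (n : ℤ_[p])) M - unitHarmonic α M := by
  have hsplit := unitHarmonic_add α n M
  rw [add_comm n M, unitHarmonic_add α M n] at hsplit
  have hshift : d ∣ unitHarmonic (α + (M : ℤ_[p])) n - unitHarmonic α n :=
    unitHarmonic_congr_left hd (by simpa using hM) n
  convert hshift using 1
  linear_combination -hsplit

theorem dvd_unitProd_sub {d : ℤ_[p]} (hd : (p : ℤ_[p]) ∣ d) (hd0 : d ≠ 0) {M : ℕ} (hM : d ∣ M)
    (α β : ℤ_[p]) : d ∣ unitProd α M - unitProd β M := by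
  obtain ⟨n, hn⟩ := exists_nat_dvd_sub hd0 (α - β)
  have h := unitProd_congr_left (α := α) (β := β + n) hd (by rwa [← sub_sub]) M
  simpa using dvd_add h (dvd_unitProd_shift hd hM β n)

theorem dvd_unitHarmonic_sub {d : ℤ_[p]} (hd : (p : ℤ_[p]) ∣ d) (hd0 : d ≠ 0) {M : ℕ} (hM : d ∣ M)
    (α β : ℤ_[p]) : d ∣ unitHarmonic α M - unitHarmonic β M := by
  obtain ⟨n, hn⟩ := exists_nat_dvd_sub hd0 (α - β)
  have h := unitHarmonic_congr_left (α := α) (β := β + n) hd (by rwa [← sub_sub]) M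
  simpa using dvd_add h (dvd_unitHarmonic_shift hd hM β n)

theorem unitHarmonic_reflect (α : ℤ_[p]) (M : ℕ) :
    unitHarmonic (-α - (M : ℤ_[p]) + 1) M = -unitHarmonic α M := by
  rw [unitHarmonic, unitHarmonic, ← Finset.sum_range_reflect, ← Finset.sum_neg_distrib]
  refine Finset.sum_congr rfl fun i hi => ?_
  have hi' := Finset.mem_range.1 hi
  rw [← unitInv_neg, Nat.sub_sub, Nat.cast_sub (by lia)]
  congr 1
  push_cast
  ring

theorem dvd_two_mul_unitHarmonic {d : ℤ_[p]} (hd : (p : ℤ_[p]) ∣ d) (hd0 : d ≠ 0) {M : ℕ}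
    (hM : d ∣ M) (α : ℤ_[p]) : d ∣ 2 * unitHarmonic α M := by
  have h := dvd_unitHarmonic_sub hd hd0 hM α (-α - (M : ℤ_[p]) + 1)
  rwa [unitHarmonic_reflect, sub_neg_eq_add, ← two_mul] at h

theorem unitProd_add_left {d : ℤ_[p]} (hd : (p : ℤ_[p]) ∣ d) (α : ℤ_[p]) (M : ℕ) :
    unitProd (α + d) M =
      unitProd α M * ∏ i ∈ Finset.range M, (1 + d * unitInv (α + (i : ℤ_[p]))) := by
  rw [unitProd, unitProd, ← Finset.prod_mul_distrib]
  refine Finset.prod_congr rfl fun i _ => ?_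
  rw [← unitPart_add hd]
  ring_nf

theorem sq_dvd_unitProd_add_left {d : ℤ_[p]} (hd : (p : ℤ_[p]) ∣ d) (α : ℤ_[p]) (M : ℕ) :
    d ^ 2 ∣ unitProd (α + d) M - unitProd α M * (1 + d * unitHarmonic α M) := by
  rw [unitProd_add_left hd, ← mul_sub]
  exact Dvd.dvd.mul_left (sq_dvd_prod_one_add_sub d (Finset.range M) _) _

theorem mul_dvd_unitProd_add {M N : ℕ} (hM : p ∣ M) (hN : p ∣ N) (α : ℤ_[p]) :
    (M * N : ℤ_[p]) ∣ 2 * (unitProd α (M + N) - unitProd α M * unitProd α N) := by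
  wlog h : (M : ℤ_[p]) ∣ N generalizing M N
  · have h' : (N : ℤ_[p]) ∣ M := (ValuationRing.dvd_total _ _).resolve_left h
    have := this hN hM h'
    rwa [add_comm, mul_comm (N : ℤ_[p]), mul_comm (unitProd α N)] at this
  rcases eq_or_ne M 0 with rfl | hM0
  · simp [unitProd]
  have hN' : (p : ℤ_[p]) ∣ N := Nat.cast_dvd_cast hN
  have hM' : (p : ℤ_[p]) ∣ M := Nat.cast_dvd_cast hM
  have hMN : (M * N : ℤ_[p]) ∣ (N : ℤ_[p]) ^ 2 := by
    rw [sq]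
    exact mul_dvd_mul_right h _
  have hlin : (M * N : ℤ_[p]) ∣ N * (2 * unitHarmonic α M) := by
    rw [mul_comm]
    exact mul_dvd_mul_left _ (dvd_two_mul_unitHarmonic hM' (by exact_mod_cast hM0) dvd_rfl α)
  have hquad := hMN.trans (sq_dvd_unitProd_add_left hN' α M)
  rw [add_comm, unitProd_add]
  convert dvd_add (hquad.mul_right (2 * unitProd α N))
    (hlin.mul_right (unitProd α M * unitProd α N)) using 1
  ring

theorem sq_dvd_unitProd_one_add {M : ℕ} (hM : p ∣ M) (n : ℕ) :
    (M : ℤ_[p]) ^ 2 ∣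
      unitProd (1 + (n : ℤ_[p])) M - unitProd 1 M * (1 + (M : ℤ_[p]) * unitHarmonic 1 n) := by
  have hsplit := unitProd_add (1 : ℤ_[p]) n M
  rw [add_comm n M, unitProd_add] at hsplit
  refine (isUnit_unitProd 1 n).dvd_mul_left.1 ?_
  have hshift := sq_dvd_unitProd_add_left (Nat.cast_dvd_cast hM : (p : ℤ_[p]) ∣ M) 1 n
  convert hshift.mul_left (unitProd 1 M) using 1
  linear_combination -hsplit

theorem ascPochhammer_eval_eq_prod {R : Type*} [CommSemiring R] (x : R) (n : ℕ) :
    (ascPochhammer R n).eval x = ∏ i ∈ Finset.range n, (x + i) := by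
  induction n with
  | zero => simp
  | succ n ih => rw [ascPochhammer_succ_eval, ih, Finset.prod_range_succ]

theorem coe_ascPochhammer_eval (α : ℤ_[p]) (n : ℕ) :
    (((ascPochhammer ℤ_[p] n).eval α : ℤ_[p]) : ℚ_[p]) =
      (ascPochhammer ℚ_[p] n).eval (α : ℚ_[p]) := by
  simp only [ascPochhammer_eval_eq_prod, coe_prod, PadicInt.coe_add, PadicInt.coe_natCast]

theorem ascPochhammer_eval_ne_zero {α : ℤ_[p]} (h : ∀ m : ℕ, α ≠ -(m : ℤ_[p])) (n : ℕ) :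
    (ascPochhammer ℚ_[p] n).eval (α : ℚ_[p]) ≠ 0 := by
  rw [← coe_ascPochhammer_eval, PadicInt.coe_ne_zero, Ne, ascPochhammer_eval_eq_zero_iff]
  exact fun ⟨m, _, hm⟩ => h m (neg_eq_iff_eq_neg.1 hm.symm)

theorem lastDigit_lt (α : ℤ_[p]) : lastDigit α < p := PadicInt.zmodRepr_lt_p _

theorem dvd_add_iff_eq_lastDigit (α : ℤ_[p]) {l : ℕ} (hl : l < p) (u : ℕ) :
    (p : ℤ_[p]) ∣ α + ((l + u * p : ℕ) : ℤ_[p]) ↔ l = lastDigit α := by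
  have e : α + ((l + u * p : ℕ) : ℤ_[p]) = (α + l) + p * u := by push_cast; ring
  rw [e, dvd_add_left (dvd_mul_right _ _)]
  constructor
  · intro h
    refine (PadicInt.zmodRepr_unique _ _ hl ?_).symm
    rw [PadicInt.maximalIdeal_eq_span_p, Ideal.mem_span_singleton]
    rw [← dvd_neg]
    convert h using 1
    ring
  · rintro rfl
    exact dvd_add_lastDigit α

theorem add_lastDigit_eq (α : ℤ_[p]) (u : ℕ) :
    α + ((lastDigit α + u * p : ℕ) : ℤ_[p]) = p * (dworkPrime α + u) := by
  rw [mul_add, mul_dworkPrime]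
  push_cast
  ring

theorem prod_multPart (α : ℤ_[p]) {l : ℕ} (hl : l ≤ p) (u : ℕ) :
    ∏ i ∈ Finset.range l, multPart (α + ((i + u * p : ℕ) : ℤ_[p])) =
      if lastDigit α < l then (p : ℤ_[p]) * (dworkPrime α + u) else 1 := by
  have h : ∀ i ∈ Finset.range l, multPart (α + ((i + u * p : ℕ) : ℤ_[p])) =
      if i = lastDigit α then (p : ℤ_[p]) * (dworkPrime α + u) else 1 := by
    intro i hi
    have hi' : i < p := (Finset.mem_range.1 hi).trans_le hl
    unfold multPart
    rw [dvd_add_iff_eq_lastDigit α hi' u]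
    split_ifs with h
    · rw [h, add_lastDigit_eq]
    · rfl
  rw [Finset.prod_congr rfl h, Finset.prod_ite_eq']
  simp

theorem ascPochhammer_eval_add_mul (α : ℤ_[p]) {l : ℕ} (hl : l ≤ p) (u : ℕ) :
    (ascPochhammer ℤ_[p] (l + u * p)).eval α = unitProd α (l + u * p) *
      (p ^ u * (ascPochhammer ℤ_[p] u).eval (dworkPrime α) *
        if lastDigit α < l then (p : ℤ_[p]) * (dworkPrime α + u) else 1) := by
  have hsplit : (ascPochhammer ℤ_[p] (l + u * p)).eval α =
      unitProd α (l + u * p) * ∏ i ∈ Finset.range (l + u * p), multPart (α + (i : ℤ_[p])) := by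
    rw [ascPochhammer_eval_eq_prod, unitProd, ← Finset.prod_mul_distrib]
    exact Finset.prod_congr rfl fun i _ => (unitPart_mul_multPart _).symm
  have hblock : ∀ i ∈ Finset.range u,
      ∏ j ∈ Finset.range p, multPart (α + ((j + i * p : ℕ) : ℤ_[p])) = p * (dworkPrime α + i) :=
    fun i _ => by rw [prod_multPart α le_rfl, if_pos (lastDigit_lt α)]
  rw [hsplit, add_comm l, Finset.prod_range_add, mul_comm u p, prod_range_eq_prod_blocks,
    Finset.prod_congr rfl hblock, Finset.prod_mul_distrib, ← ascPochhammer_eval_eq_prod,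
    ← prod_multPart α hl u]
  simp [mul_comm p u, add_comm]

end UnitProducts

section Products

variable {k : Type*} [NormedField k]

theorem norm_prod_le_one {ι : Type*} (s : Finset ι) (f : ι → k) (h : ∀ i ∈ s, ‖f i‖ ≤ 1) :
    ‖∏ i ∈ s, f i‖ ≤ 1 := by
  rw [norm_prod]
  exact Finset.prod_le_one (fun i _ => norm_nonneg _) h

variable [IsUltrametricDist k]

theorem mul_norm_mul_sub_mul_le {c δ : ℝ} (hc : 0 ≤ c) {x y x' y' : k}
    (h : c * ‖x - y‖ ≤ δ) (h' : c * ‖x' - y'‖ ≤ δ) (hx : ‖x'‖ ≤ 1) (hy : ‖y‖ ≤ 1) :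
    c * ‖x * x' - y * y'‖ ≤ δ := by
  have e : x * x' - y * y' = (x - y) * x' + y * (x' - y') := by ring
  rw [e]
  refine (mul_le_mul_of_nonneg_left (IsUltrametricDist.norm_add_le_max _ _) hc).trans ?_
  rw [mul_max_of_nonneg _ _ hc, norm_mul, norm_mul]
  refine max_le (le_trans ?_ h) (le_trans ?_ h')
  · exact mul_le_mul_of_nonneg_left (mul_le_of_le_one_right (norm_nonneg _) hx) hc
  · exact mul_le_mul_of_nonneg_left (mul_le_of_le_one_left (norm_nonneg _) hy) hc

theorem mul_norm_prod_sub_prod_le {ι : Type*} {c δ : ℝ} (hc : 0 ≤ c) (hδ : 0 ≤ δ)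
    (s : Finset ι) (f g : ι → k) (h : ∀ i ∈ s, c * ‖f i - g i‖ ≤ δ)
    (hf : ∀ i ∈ s, ‖f i‖ ≤ 1) (hg : ∀ i ∈ s, ‖g i‖ ≤ 1) :
    c * ‖∏ i ∈ s, f i - ∏ i ∈ s, g i‖ ≤ δ := by
  classical
  induction s using Finset.induction_on with
  | empty => simpa using hδ
  | insert a s ha ih =>
    rw [Finset.prod_insert ha, Finset.prod_insert ha]
    simp only [Finset.mem_insert, forall_eq_or_imp] at h hf hg
    exact mul_norm_mul_sub_mul_le hc h.1 (ih h.2 hf.2 hg.2) (norm_prod_le_one _ _ hf.2) hg.1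

end Products

section Coefficients

variable {p : ℕ} [Fact p.Prime] {ι : Type*}

theorem dworkIter_zero (α : ℤ_[p]) : dworkIter 0 α = α := rfl

theorem dworkIter_succ (r : ℕ) (α : ℤ_[p]) :
    dworkIter (r + 1) α = dworkPrime (dworkIter r α) := Function.iterate_succ_apply' _ _ _

theorem lastDigit_one : lastDigit (1 : ℤ_[p]) = p - 1 := by
  have hp : 1 ≤ p := (Fact.out : p.Prime).one_lt.le
  refine ((dvd_add_iff_eq_lastDigit (1 : ℤ_[p]) (l := p - 1) (by lia) 0).1 ?_).symm
  rw [zero_mul, add_zero, Nat.cast_sub hp]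
  simp

theorem dworkPrime_one : dworkPrime (1 : ℤ_[p]) = 1 := by
  have hp : 1 ≤ p := (Fact.out : p.Prime).one_lt.le
  have h := mul_dworkPrime (1 : ℤ_[p])
  rw [lastDigit_one, Nat.cast_sub hp] at h
  have hp0 : (p : ℤ_[p]) ≠ 0 := by exact_mod_cast (Fact.out : p.Prime).ne_zero
  refine mul_left_cancel₀ hp0 ?_
  simp [h]

theorem dworkIter_one (r : ℕ) : dworkIter r (1 : ℤ_[p]) = 1 := by
  induction r with
  | zero => rfl
  | succ r ih => rw [dworkIter_succ, ih, dworkPrime_one]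

theorem dworkPrime_ne_neg {α : ℤ_[p]} (h : ∀ m : ℕ, α ≠ -(m : ℤ_[p])) (m : ℕ) :
    dworkPrime α ≠ -(m : ℤ_[p]) := by
  intro hm
  refine h (lastDigit α + m * p) ?_
  have := add_lastDigit_eq α m
  rw [hm, neg_add_cancel, mul_zero] at this
  exact eq_neg_of_add_eq_zero_left this

theorem norm_add_eq_one {α : ℤ_[p]} {l : ℕ} (hl : l < p) (h : lastDigit α ≠ l) (u : ℕ) :
    ‖α + ((l + u * p : ℕ) : ℤ_[p])‖ = 1 :=
  PadicInt.isUnit_iff.1 (isUnit_of_not_dvd fun hd =>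
    h ((dvd_add_iff_eq_lastDigit α hl u).1 hd).symm)

theorem norm_add_eq {α : ℤ_[p]} {l : ℕ} (hl : l < p) (u : ℕ) :
    ‖α + ((l + u * p : ℕ) : ℤ_[p])‖ =
      if lastDigit α = l then (p : ℝ)⁻¹ * ‖dworkPrime α + u‖ else 1 := by
  split_ifs with h
  · subst h
    rw [add_lastDigit_eq, norm_mul, PadicInt.norm_p]
  · exact norm_add_eq_one hl h u

theorem prod_norm_add_eq {l : ℕ} (hl : l < p) (b : ι → ℤ_[p]) (J : Finset ι) (u : ℕ) :
    ∏ j ∈ J, ‖b j + ((l + u * p : ℕ) : ℤ_[p])‖ =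
      (p : ℝ)⁻¹ ^ (J.filter fun j => lastDigit (b j) = l).card *
        ∏ j ∈ J with lastDigit (b j) = l, ‖dworkPrime (b j) + (u : ℤ_[p])‖ := by
  rw [← Finset.prod_const, ← Finset.prod_mul_distrib, Finset.prod_filter]
  exact Finset.prod_congr rfl fun j _ => norm_add_eq hl u

variable [Fintype ι]

/-- Parameters `a`, `b` of a balanced hypergeometric series subject to Dwork's conditions, where
`J` is a set of indices outside of which `b` is `1`. Condition (ii) on the sorted digits is encoded
by counting digits. -/
structure DworkData (a b : ι → ℤ_[p]) (J : Finset ι) : Prop where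
  num_ne : ∀ i (m : ℕ), a i ≠ -(m : ℤ_[p])
  den_ne : ∀ i (m : ℕ), b i ≠ -(m : ℤ_[p])
  norm_eq_one : ∀ j ∈ J, ∀ r, ‖dworkIter r (b j)‖ = 1
  eq_one : ∀ j, j ∉ J → b j = 1
  card_lt : ∀ r l, (∃ j ∈ J, dworkDigit r (b j) ≤ l) →
    (J.filter fun j => dworkDigit r (b j) ≤ l).card <
      (Finset.univ.filter fun i => dworkDigit r (a i) < l).card

/-- The coefficients `∏ (a_i)_n / ∏ (b_i)_n`. -/
def coefRatio (a b : ι → ℤ_[p]) (n : ℕ) : ℚ_[p] :=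
  (∏ i, (ascPochhammer ℚ_[p] n).eval (a i : ℚ_[p])) /
    ∏ i, (ascPochhammer ℚ_[p] n).eval (b i : ℚ_[p])

/-- The ratio of the unit parts of the coefficients `∏ (a_i)_n / ∏ (b_i)_n`. -/
def unitRatio (a b : ι → ℤ_[p]) (n : ℕ) : ℚ_[p] :=
  (∏ i, (unitProd (a i) n : ℚ_[p])) / ∏ i, (unitProd (b i) n : ℚ_[p])

/-- The number of parameters `c_i` for which `p` divides one of
`c_i + u p, …, c_i + u p + l - 1`. -/
def carryCount (c : ι → ℤ_[p]) (l : ℕ) : ℕ := (Finset.univ.filter fun i => lastDigit (c i) < l).card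

/-- The product of the multiples of `p` among the `c_i + u p, …, c_i + u p + l - 1`, each divided
by `p`. -/
def carryProd (c : ι → ℤ_[p]) (l u : ℕ) : ℚ_[p] :=
  ∏ i with lastDigit (c i) < l, ((dworkPrime (c i) + u : ℤ_[p]) : ℚ_[p])

theorem norm_unitProd (α : ℤ_[p]) (n : ℕ) : ‖(unitProd α n : ℚ_[p])‖ = 1 :=
  PadicInt.isUnit_iff.1 (isUnit_unitProd α n)

theorem norm_unitRatio (a b : ι → ℤ_[p]) (n : ℕ) : ‖unitRatio a b n‖ = 1 := by
  simp only [unitRatio, norm_div, norm_prod, norm_unitProd, Finset.prod_const_one, div_one]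

theorem norm_carryProd_le_one (c : ι → ℤ_[p]) (l u : ℕ) : ‖carryProd c l u‖ ≤ 1 :=
  norm_prod_le_one _ _ fun _ _ => PadicInt.norm_le_one _

theorem coefRatio_zero (a b : ι → ℤ_[p]) : coefRatio a b 0 = 1 := by
  simp [coefRatio]

theorem prod_ascPochhammer_eval_add_mul (c : ι → ℤ_[p]) {l : ℕ} (hl : l ≤ p) (u : ℕ) :
    ∏ i, (ascPochhammer ℚ_[p] (l + u * p)).eval (c i : ℚ_[p]) =
      (∏ _i : ι, (p : ℚ_[p]) ^ u) * (∏ i, (ascPochhammer ℚ_[p] u).eval (dworkPrime (c i) : ℚ_[p])) *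
        ((∏ i, (unitProd (c i) (l + u * p) : ℚ_[p])) *
          ((p : ℚ_[p]) ^ carryCount c l * carryProd c l u)) := by
  have hcarry : (p : ℚ_[p]) ^ carryCount c l * carryProd c l u =
      ∏ i, if lastDigit (c i) < l then (p : ℚ_[p]) * (dworkPrime (c i) + u : ℤ_[p]) else 1 := by
    rw [carryCount, carryProd, ← Finset.prod_const, ← Finset.prod_mul_distrib, Finset.prod_filter]
  rw [hcarry, ← Finset.prod_mul_distrib, ← Finset.prod_mul_distrib, ← Finset.prod_mul_distrib]
  refine Finset.prod_congr rfl fun i _ => ?_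
  rw [← coe_ascPochhammer_eval, ← coe_ascPochhammer_eval, ascPochhammer_eval_add_mul _ hl]
  split_ifs <;> push_cast <;> ring

theorem coefRatio_step (a b : ι → ℤ_[p]) {l : ℕ} (hl : l ≤ p) (u : ℕ) :
    coefRatio a b (l + u * p) =
      coefRatio (fun i => dworkPrime (a i)) (fun i => dworkPrime (b i)) u *
        ((p : ℚ_[p]) ^ carryCount a l / (p : ℚ_[p]) ^ carryCount b l *
          (unitRatio a b (l + u * p) * carryProd a l u / carryProd b l u)) := by
  have hp : (∏ _i : ι, (p : ℚ_[p]) ^ u) ≠ 0 := Finset.prod_ne_zero_iff.2 fun i _ =>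
    pow_ne_zero _ (by exact_mod_cast (Fact.out : p.Prime).ne_zero)
  rw [coefRatio, prod_ascPochhammer_eval_add_mul a hl, prod_ascPochhammer_eval_add_mul b hl,
    mul_div_mul_comm, mul_div_mul_left _ _ hp, coefRatio, unitRatio]
  simp only [div_eq_mul_inv, mul_inv]
  ring

end Coefficients

section Gauge

variable {p : ℕ} [Fact p.Prime] {ι : Type*} [Fintype ι] {a b : ι → ℤ_[p]} {J : Finset ι}

theorem inv_prime_pos : 0 < (p : ℝ)⁻¹ := inv_pos.2 (by exact_mod_cast (Fact.out : p.Prime).pos)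

theorem inv_prime_le_one : (p : ℝ)⁻¹ ≤ 1 :=
  inv_le_one_of_one_le₀ (by exact_mod_cast (Fact.out : p.Prime).one_lt.le)

/-- Dwork's gauge of the coefficient sequence, a majorant for the norm of the coefficients that
absorbs the denominators arising in their congruences. -/
def coefGauge (a b : ι → ℤ_[p]) (J : Finset ι) (n : ℕ) : ℝ :=
  ‖coefRatio a b n‖ / ∏ j ∈ J, ‖b j + n‖

/-- The coefficients with parameters replaced by their `r`-th Dwork primes. -/
def coefIter (a b : ι → ℤ_[p]) (r : ℕ) : ℕ → ℚ_[p] :=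
  coefRatio (fun i => dworkIter r (a i)) (fun i => dworkIter r (b i))

/-- The gauge of `coefIter`. -/
def gaugeIter (a b : ι → ℤ_[p]) (J : Finset ι) (r : ℕ) : ℕ → ℝ :=
  coefGauge (fun i => dworkIter r (a i)) (fun i => dworkIter r (b i)) J

/-- The numerator of the difference of `A (l + w p) / A' w` and `A (l + u p) / A' u`, where `A` and
`A'` are the coefficients for the parameters `a`, `b` and their Dwork primes. -/
def ratioDiff (a b : ι → ℤ_[p]) (l u w : ℕ) : ℚ_[p] :=
  unitRatio a b (l + w * p) * carryProd a l w -
    unitRatio a b (l + u * p) * carryProd a l u * (carryProd b l w / carryProd b l u)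

theorem norm_unitRatio_sub_le (a b : ι → ℤ_[p]) (l u s n : ℕ) :
    ‖unitRatio a b (l + (u + n * p ^ s) * p) - unitRatio a b (l + u * p)‖ ≤
      (p : ℝ)⁻¹ ^ (s + 1) := by
  set M := l + u * p with hM
  set V : ℤ_[p] → ℤ_[p] := fun α => unitProd (α + (M : ℤ_[p])) (n * p ^ (s + 1)) with hV
  have norm_prod_V (c : ι → ℤ_[p]) : ‖∏ i, (V (c i) : ℚ_[p])‖ = 1 := by
    rw [norm_prod]
    exact Finset.prod_eq_one fun i _ => norm_unitProd _ _
  have hb : ∏ i, (V (b i) : ℚ_[p]) ≠ 0 := norm_pos_iff.1 (by rw [norm_prod_V]; exact one_pos)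
  have hsplit : unitRatio a b (l + (u + n * p ^ s) * p) = unitRatio a b M *
      ((∏ i, (V (a i) : ℚ_[p])) / ∏ i, (V (b i) : ℚ_[p])) := by
    rw [show l + (u + n * p ^ s) * p = M + n * p ^ (s + 1) by rw [hM]; ring, unitRatio, unitRatio,
      div_mul_div_comm, ← Finset.prod_mul_distrib, ← Finset.prod_mul_distrib]
    simp only [hV, unitProd_add, PadicInt.coe_mul]
  have hdvd : (p : ℤ_[p]) ^ (s + 1) ∣ ∏ i, V (a i) - ∏ i, V (b i) :=
    dvd_prod_sub_prod _ _ _ _ fun i _ =>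
      dvd_unitProd_sub (dvd_pow_self _ (Nat.succ_ne_zero s))
        (pow_ne_zero _ (by exact_mod_cast (Fact.out : p.Prime).ne_zero)) (by simp) _ _
  rw [← norm_le_inv_pow_iff, PadicInt.coe_sub, coe_prod, coe_prod] at hdvd
  rwa [hsplit, ← mul_sub_one, div_sub_one hb, norm_mul, norm_unitRatio, one_mul, norm_div,
    norm_prod_V, div_one]

namespace DworkData

theorem prime (h : DworkData a b J) :
    DworkData (fun i => dworkPrime (a i)) (fun i => dworkPrime (b i)) J where
  num_ne i := dworkPrime_ne_neg (h.num_ne i)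
  den_ne i := dworkPrime_ne_neg (h.den_ne i)
  norm_eq_one j hj r := h.norm_eq_one j hj (r + 1)
  eq_one j hj := by rw [h.eq_one j hj, dworkPrime_one]
  card_lt r := h.card_lt (r + 1)

theorem iter (h : DworkData a b J) (r : ℕ) :
    DworkData (fun i => dworkIter r (a i)) (fun i => dworkIter r (b i)) J := by
  induction r with
  | zero => exact h
  | succ r ih => simpa only [dworkIter_succ] using ih.prime

theorem mem_of_lastDigit_lt (h : DworkData a b J) {j : ι} {l : ℕ} (hl : l < p)
    (hj : lastDigit (b j) < l) : j ∈ J := by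
  by_contra hJ
  rw [h.eq_one j hJ, lastDigit_one] at hj
  lia

theorem filter_eq (h : DworkData a b J) {l : ℕ} (hl : l < p) :
    (Finset.univ.filter fun j => lastDigit (b j) < l) = J.filter fun j => lastDigit (b j) < l := by
  ext j
  simpa using fun hj => h.mem_of_lastDigit_lt hl hj

theorem coefRatio_ne_zero (h : DworkData a b J) (n : ℕ) : coefRatio a b n ≠ 0 :=
  div_ne_zero (Finset.prod_ne_zero_iff.2 fun i _ => ascPochhammer_eval_ne_zero (h.num_ne i) n)
    (Finset.prod_ne_zero_iff.2 fun i _ => ascPochhammer_eval_ne_zero (h.den_ne i) n)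

theorem norm_add_pos (h : DworkData a b J) (j : ι) (n : ℕ) : 0 < ‖b j + n‖ :=
  norm_pos_iff.2 fun h0 => h.den_ne j n (eq_neg_of_add_eq_zero_left h0)

theorem prod_norm_add_pos (h : DworkData a b J) (s : Finset ι) (n : ℕ) :
    0 < ∏ j ∈ s, ‖b j + n‖ := Finset.prod_pos fun j _ => h.norm_add_pos j n

theorem coefGauge_nonneg (h : DworkData a b J) (n : ℕ) : 0 ≤ coefGauge a b J n :=
  div_nonneg (norm_nonneg _) (h.prod_norm_add_pos J n).le

theorem coefGauge_mul (h : DworkData a b J) (n : ℕ) :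
    coefGauge a b J n * ∏ j ∈ J, ‖b j + n‖ = ‖coefRatio a b n‖ :=
  div_mul_cancel₀ _ (h.prod_norm_add_pos J n).ne'

theorem norm_coefRatio_le (h : DworkData a b J) (n : ℕ) :
    ‖coefRatio a b n‖ ≤ coefGauge a b J n := by
  rw [← h.coefGauge_mul]
  refine mul_le_of_le_one_right (h.coefGauge_nonneg n) (Finset.prod_le_one ?_ ?_)
  · exact fun _ _ => norm_nonneg _
  · exact fun _ _ => PadicInt.norm_le_one _

theorem coefGauge_zero (h : DworkData a b J) : coefGauge a b J 0 = 1 := by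
  rw [coefGauge, coefRatio_zero, norm_one, Finset.prod_eq_one, div_one]
  intro j hj
  simpa [dworkIter_zero] using h.norm_eq_one j hj 0

theorem carryProd_ne_zero (h : DworkData a b J) (l u : ℕ) : carryProd b l u ≠ 0 :=
  Finset.prod_ne_zero_iff.2 fun j _ => norm_pos_iff.1 (h.prime.norm_add_pos j u)

theorem card_filter_le_eq (h : DworkData a b J) {l : ℕ} (hl : l < p) :
    (J.filter fun j => lastDigit (b j) ≤ l).card =
      carryCount b l + (J.filter fun j => lastDigit (b j) = l).card := by
  classical
  rw [carryCount, h.filter_eq hl, ← Finset.card_union_of_disjoint, ← Finset.filter_or]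
  · simp only [le_iff_lt_or_eq]
  · exact Finset.disjoint_filter.2 fun j _ hlt heq => hlt.ne heq

theorem card_filter_lt_or_eq_zero (h : DworkData a b J) (l : ℕ) :
    (J.filter fun j => lastDigit (b j) ≤ l).card < carryCount a l ∨
      (J.filter fun j => lastDigit (b j) ≤ l).card = 0 ∧ carryCount a l = 0 := by
  rcases (J.filter fun j => lastDigit (b j) ≤ l).eq_empty_or_nonempty with hJ | ⟨j, hj⟩
  · rw [hJ, Finset.card_empty]
    exact (Nat.eq_zero_or_pos _).symm.imp_right fun h0 => ⟨rfl, h0⟩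
  · exact Or.inl (h.card_lt 0 l ⟨j, Finset.mem_filter.1 hj⟩)

theorem norm_coefRatio_prime_le (h : DworkData a b J) {l : ℕ} (hl : l < p) {u w : ℕ}
    (huw : ∀ j ∈ J, ‖dworkPrime (b j) + (w : ℤ_[p])‖ ≤ ‖dworkPrime (b j) + (u : ℤ_[p])‖) :
    ‖coefRatio (fun i => dworkPrime (a i)) (fun i => dworkPrime (b i)) w‖ ≤
      coefGauge (fun i => dworkPrime (a i)) (fun i => dworkPrime (b i)) J w *
        (‖carryProd b l w‖ *
          ∏ j ∈ J with lastDigit (b j) = l, ‖dworkPrime (b j) + (u : ℤ_[p])‖) := by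
  rw [← h.prime.coefGauge_mul w]
  refine mul_le_mul_of_nonneg_left ?_ (h.prime.coefGauge_nonneg w)
  rw [carryProd, h.filter_eq hl, norm_prod, Finset.prod_filter, Finset.prod_filter,
    ← Finset.prod_mul_distrib]
  refine Finset.prod_le_prod (fun j _ => norm_nonneg _) fun j hj => ?_
  rcases lt_trichotomy (lastDigit (b j)) l with hlt | heq | hgt
  · simp only [hlt, hlt.ne, if_true, if_false, mul_one]
    exact le_rfl
  · simpa [heq] using huw j hj
  · simpa [hgt.not_gt, hgt.ne'] using PadicInt.norm_le_one (dworkPrime (b j) + (w : ℤ_[p]))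

theorem coefGauge_step_le (h : DworkData a b J) {l : ℕ} (hl : l < p) (u : ℕ) :
    coefGauge a b J (l + u * p) * (p : ℝ)⁻¹ ^ (J.filter fun j => lastDigit (b j) ≤ l).card ≤
      (p : ℝ)⁻¹ ^ carryCount a l *
        coefGauge (fun i => dworkPrime (a i)) (fun i => dworkPrime (b i)) J u := by
  have hε : 0 < (p : ℝ)⁻¹ := inv_prime_pos
  have hb := norm_pos_iff.2 (h.carryProd_ne_zero l u)
  have hD := h.prime.prod_norm_add_pos (J.filter fun j => lastDigit (b j) = l) u
  have hA := h.norm_coefRatio_prime_le hl (u := u) fun j _ => le_rfl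
  rw [coefGauge, prod_norm_add_eq hl, coefRatio_step a b hl.le, h.card_filter_le_eq hl, pow_add,
    norm_mul, norm_mul, norm_div, norm_div, norm_mul, norm_unitRatio, norm_pow, norm_pow,
    Padic.norm_p, one_mul]
  set A' := coefRatio (fun i => dworkPrime (a i)) (fun i => dworkPrime (b i)) u
  set D := ∏ j ∈ J with lastDigit (b j) = l, ‖dworkPrime (b j) + (u : ℤ_[p])‖
  generalize (p : ℝ)⁻¹ = ε at hε ⊢
  calc _ = ε ^ carryCount a l * (‖carryProd a l u‖ * (‖A'‖ / (‖carryProd b l u‖ * D))) := by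
        field_simp
    _ ≤ _ := by
        refine mul_le_mul_of_nonneg_left ?_ (by positivity)
        refine (mul_le_of_le_one_left (by positivity) (norm_carryProd_le_one a l u)).trans ?_
        rwa [div_le_iff₀ (mul_pos hb hD)]

theorem coefGauge_le_prime_mul_pow (h : DworkData a b J) {l : ℕ} (hl : l < p) (u : ℕ) {d : ℕ}
    (hd : (J.filter fun j => lastDigit (b j) ≤ l).card + d ≤ carryCount a l) :
    coefGauge a b J (l + u * p) ≤
      coefGauge (fun i => dworkPrime (a i)) (fun i => dworkPrime (b i)) J u * (p : ℝ)⁻¹ ^ d := by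
  have hε : 0 < (p : ℝ)⁻¹ := inv_prime_pos
  refine le_of_mul_le_mul_right ((h.coefGauge_step_le hl u).trans ?_)
    (pow_pos hε (J.filter fun j => lastDigit (b j) ≤ l).card)
  rw [mul_comm, mul_assoc, ← pow_add, add_comm d]
  exact mul_le_mul_of_nonneg_left (pow_le_pow_of_le_one hε.le inv_prime_le_one hd)
    (h.prime.coefGauge_nonneg _)

theorem coefGauge_le_prime (h : DworkData a b J) {l : ℕ} (hl : l < p) (u : ℕ) :
    coefGauge a b J (l + u * p) ≤
      coefGauge (fun i => dworkPrime (a i)) (fun i => dworkPrime (b i)) J u := by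
  have hd : (J.filter fun j => lastDigit (b j) ≤ l).card + 0 ≤ carryCount a l := by
    rcases h.card_filter_lt_or_eq_zero l with hlt | ⟨hJ, -⟩ <;> lia
  simpa using h.coefGauge_le_prime_mul_pow hl u hd

theorem gaugeIter_nonneg (h : DworkData a b J) (r n : ℕ) : 0 ≤ gaugeIter a b J r n :=
  (h.iter r).coefGauge_nonneg n

theorem gaugeIter_le_succ (h : DworkData a b J) (r l u : ℕ) (hl : l < p) :
    gaugeIter a b J r (l + u * p) ≤ gaugeIter a b J (r + 1) u := by
  simpa only [gaugeIter, dworkIter_succ] using (h.iter r).coefGauge_le_prime hl u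

theorem gaugeIter_le_one (h : DworkData a b J) (r n : ℕ) : gaugeIter a b J r n ≤ 1 := by
  induction n using Nat.strong_induction_on generalizing r with
  | _ n ih =>
  have hp : p.Prime := Fact.out
  rcases Nat.eq_zero_or_pos n with rfl | hn
  · exact (h.iter r).coefGauge_zero.le
  · have hstep := h.gaugeIter_le_succ r (n % p) (n / p) (Nat.mod_lt _ hp.pos)
    rw [mul_comm (n / p), Nat.mod_add_div] at hstep
    exact hstep.trans (ih _ (Nat.div_lt_self hn hp.one_lt) _)

theorem gaugeIter_le_add (h : DworkData a b J) (r s u n : ℕ) (hu : u < p ^ s) :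
    gaugeIter a b J r (u + n * p ^ s) ≤ gaugeIter a b J (r + s) n := by
  induction s generalizing r u with
  | zero =>
    obtain rfl : u = 0 := by simpa using hu
    simp
  | succ s ih =>
    obtain ⟨l, hl, u, hu', rfl⟩ := exists_eq_add_mul_of_lt_pow_succ hu
    rw [show l + u * p + n * p ^ (s + 1) = l + (u + n * p ^ s) * p by ring,
      show r + (s + 1) = r + 1 + s by ring]
    exact (h.gaugeIter_le_succ r l _ hl).trans (ih (r + 1) u hu')

theorem gaugeIter_le_mul_norm (h : DworkData a b J) {j : ι} (hj : j ∈ J)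
    (r s u n : ℕ) (hu : u < p ^ s) :
    gaugeIter a b J r (u + n * p ^ s) ≤ gaugeIter a b J (r + s) n * ‖dworkIter r (b j) + u‖ := by
  induction s generalizing r u with
  | zero =>
    obtain rfl : u = 0 := by simpa using hu
    simp [h.norm_eq_one j hj r]
  | succ s ih =>
    obtain ⟨l, hl, u, hu', rfl⟩ := exists_eq_add_mul_of_lt_pow_succ hu
    rw [norm_add_eq hl]
    split_ifs with hdigit
    · have hstep := (h.iter r).coefGauge_le_prime_mul_pow hl (u + n * p ^ s) (d := 1)
        ((h.iter r).card_lt 0 l ⟨j, hj, hdigit.le⟩)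
      simp only [← dworkIter_succ, pow_one] at hstep
      rw [show l + u * p + n * p ^ (s + 1) = l + (u + n * p ^ s) * p by ring,
        show r + (s + 1) = r + 1 + s by ring, ← dworkIter_succ, mul_left_comm, mul_comm (p : ℝ)⁻¹]
      exact hstep.trans (mul_le_mul_of_nonneg_right (ih (r + 1) u hu') inv_prime_pos.le)
    · rw [mul_one]
      exact h.gaugeIter_le_add r (s + 1) _ n hu

theorem inv_pow_le_norm_add (h : DworkData a b J) {j : ι} (hj : j ∈ J)
    (r s u : ℕ) (hu : u < p ^ s) : (p : ℝ)⁻¹ ^ s ≤ ‖dworkIter r (b j) + u‖ := by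
  induction s generalizing r u with
  | zero =>
    obtain rfl : u = 0 := by simpa using hu
    simp [h.norm_eq_one j hj r]
  | succ s ih =>
    obtain ⟨l, hl, u, hu', rfl⟩ := exists_eq_add_mul_of_lt_pow_succ hu
    rw [norm_add_eq hl]
    split_ifs
    · rw [pow_succ', ← dworkIter_succ]
      exact mul_le_mul_of_nonneg_left (ih _ _ hu') inv_prime_pos.le
    · exact pow_le_one₀ inv_prime_pos.le inv_prime_le_one

theorem norm_add_add_mul_pow_le (h : DworkData a b J) {j : ι} (hj : j ∈ J)
    {s u : ℕ} (hu : u < p ^ s) (n : ℕ) :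
    ‖dworkPrime (b j) + ((u + n * p ^ s : ℕ) : ℤ_[p])‖ ≤ ‖dworkPrime (b j) + (u : ℤ_[p])‖ := by
  have hsplit : dworkPrime (b j) + ((u + n * p ^ s : ℕ) : ℤ_[p]) =
      (dworkPrime (b j) + (u : ℤ_[p])) + n * p ^ s := by push_cast; ring
  rw [hsplit]
  refine (PadicInt.nonarchimedean _ _).trans (max_le le_rfl ?_)
  refine le_trans ?_ (h.inv_pow_le_norm_add hj 1 s u hu)
  rw [norm_mul, norm_pow, PadicInt.norm_p]
  exact mul_le_of_le_one_left (by positivity) (PadicInt.norm_le_one _)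

end DworkData

end Gauge

section Congruence

variable {p : ℕ} [Fact p.Prime]

theorem dworkIter_dworkIter (r s : ℕ) (α : ℤ_[p]) :
    dworkIter s (dworkIter r α) = dworkIter (r + s) α := by
  rw [dworkIter, dworkIter, dworkIter, add_comm r s, Function.iterate_add_apply]

theorem norm_coe_add_add_mul_pow_sub_le (α : ℤ_[p]) (s u n : ℕ) :
    ‖((α + (u + n * p ^ s : ℕ) : ℤ_[p]) : ℚ_[p]) - ((α + u : ℤ_[p]) : ℚ_[p])‖ ≤
      (p : ℝ)⁻¹ ^ s := by
  rw [← PadicInt.coe_sub, norm_le_inv_pow_iff]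
  push_cast
  exact ⟨n, by ring⟩

namespace DworkData

variable {ι : Type*} [Fintype ι] {a b : ι → ℤ_[p]} {J : Finset ι}

theorem gaugeIter_mul_norm_sub_le (h : DworkData a b J) {s u : ℕ} (hu : u < p ^ s) (n : ℕ)
    {x y : ℚ_[p]} (hxy : ‖x - y‖ ≤ (p : ℝ)⁻¹ ^ s) :
    gaugeIter a b J 1 (u + n * p ^ s) * ‖x - y‖ ≤ (p : ℝ)⁻¹ ^ s * gaugeIter a b J (s + 1) n := by
  rw [mul_comm _ (gaugeIter a b J (s + 1) n), add_comm s]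
  exact mul_le_mul (h.gaugeIter_le_add 1 s u n hu) hxy (norm_nonneg _) (h.gaugeIter_nonneg _ _)

theorem gaugeIter_mul_norm_one_sub_div_le (h : DworkData a b J) {j : ι} (hj : j ∈ J)
    {s u : ℕ} (hu : u < p ^ s) (n : ℕ) :
    gaugeIter a b J 1 (u + n * p ^ s) *
        ‖1 - ((dworkPrime (b j) + (u + n * p ^ s : ℕ) : ℤ_[p]) : ℚ_[p]) /
          ((dworkPrime (b j) + u : ℤ_[p]) : ℚ_[p])‖ ≤
      (p : ℝ)⁻¹ ^ s * gaugeIter a b J (s + 1) n := by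
  have hpos : 0 < ‖((dworkPrime (b j) + u : ℤ_[p]) : ℚ_[p])‖ := h.prime.norm_add_pos j u
  rw [one_sub_div (norm_pos_iff.1 hpos), norm_div, norm_sub_rev, mul_div_assoc', div_le_iff₀ hpos,
    mul_assoc, mul_comm ((p : ℝ)⁻¹ ^ s), add_comm s]
  exact mul_le_mul (h.gaugeIter_le_mul_norm hj 1 s u n hu) (norm_coe_add_add_mul_pow_sub_le _ s u n)
    (norm_nonneg _) (mul_nonneg (h.gaugeIter_nonneg _ _) (norm_nonneg _))

theorem gaugeIter_mul_norm_ratioDiff_le (h : DworkData a b J) {l s u : ℕ} (hl : l < p)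
    (hu : u < p ^ s) (n : ℕ) :
    gaugeIter a b J 1 (u + n * p ^ s) * ‖ratioDiff a b l u (u + n * p ^ s)‖ ≤
      (p : ℝ)⁻¹ ^ s * gaugeIter a b J (s + 1) n := by
  have hG := h.gaugeIter_nonneg 1 (u + n * p ^ s)
  have hδ : 0 ≤ (p : ℝ)⁻¹ ^ s * gaugeIter a b J (s + 1) n :=
    mul_nonneg (by positivity) (h.gaugeIter_nonneg _ _)
  have mem_J {j : ι} (hj : j ∈ Finset.univ.filter fun j => lastDigit (b j) < l) : j ∈ J :=
    h.mem_of_lastDigit_lt hl (Finset.mem_filter.1 hj).2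
  have hunit : gaugeIter a b J 1 (u + n * p ^ s) *
      ‖unitRatio a b (l + (u + n * p ^ s) * p) - unitRatio a b (l + u * p)‖ ≤
        (p : ℝ)⁻¹ ^ s * gaugeIter a b J (s + 1) n :=
    h.gaugeIter_mul_norm_sub_le hu n <| (norm_unitRatio_sub_le a b l u s n).trans <|
      pow_le_pow_of_le_one inv_prime_pos.le inv_prime_le_one (Nat.le_succ s)
  have hnum : gaugeIter a b J 1 (u + n * p ^ s) *
      ‖carryProd a l (u + n * p ^ s) - carryProd a l u‖ ≤
        (p : ℝ)⁻¹ ^ s * gaugeIter a b J (s + 1) n :=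
    mul_norm_prod_sub_prod_le hG hδ _ _ _
      (fun i _ => h.gaugeIter_mul_norm_sub_le hu n
        (norm_coe_add_add_mul_pow_sub_le (dworkPrime (a i)) s u n))
      (fun i _ => PadicInt.norm_le_one (dworkPrime (a i) + ((u + n * p ^ s : ℕ) : ℤ_[p])))
      fun i _ => PadicInt.norm_le_one (dworkPrime (a i) + (u : ℤ_[p]))
  have hden : gaugeIter a b J 1 (u + n * p ^ s) *
      ‖1 - carryProd b l (u + n * p ^ s) / carryProd b l u‖ ≤
        (p : ℝ)⁻¹ ^ s * gaugeIter a b J (s + 1) n := by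
    have hprod := mul_norm_prod_sub_prod_le hG hδ _ (fun _ => 1) _
      (fun j hj => h.gaugeIter_mul_norm_one_sub_div_le (mem_J hj) hu n) (by simp) fun j hj => by
        rw [norm_div]
        exact div_le_one_of_le₀ (h.norm_add_add_mul_pow_le (mem_J hj) hu n) (norm_nonneg _)
    rwa [Finset.prod_const_one, Finset.prod_div_distrib] at hprod
  rw [ratioDiff, ← mul_one (unitRatio a b _ * carryProd a l (u + n * p ^ s))]
  refine mul_norm_mul_sub_mul_le hG (mul_norm_mul_sub_mul_le hG hunit hnum ?_ ?_) hden ?_ ?_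
  · exact norm_carryProd_le_one _ _ _
  · exact (norm_unitRatio _ _ _).le
  · exact norm_one.le
  · rw [norm_mul, norm_unitRatio, one_mul]
    exact norm_carryProd_le_one _ _ _

theorem coefRatio_div_sub_div (h : DworkData a b J) {l : ℕ} (hl : l ≤ p) (u w : ℕ) :
    coefRatio a b (l + w * p) / coefRatio a b (l + u * p) -
        coefRatio (fun i => dworkPrime (a i)) (fun i => dworkPrime (b i)) w /
          coefRatio (fun i => dworkPrime (a i)) (fun i => dworkPrime (b i)) u =
      coefRatio (fun i => dworkPrime (a i)) (fun i => dworkPrime (b i)) w *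
        ((p : ℚ_[p]) ^ carryCount a l / (p : ℚ_[p]) ^ carryCount b l *
          (ratioDiff a b l u w / carryProd b l w)) / coefRatio a b (l + u * p) := by
  have hA := h.coefRatio_ne_zero (l + u * p)
  have hA' := h.prime.coefRatio_ne_zero u
  have hw := h.carryProd_ne_zero l w
  have hu := h.carryProd_ne_zero l u
  rw [div_sub_div _ _ hA hA', div_eq_div_iff (mul_ne_zero hA hA') hA, ratioDiff,
    coefRatio_step a b hl w, coefRatio_step a b hl u]
  field_simp

theorem coefGauge_mul_norm_sub_le (h : DworkData a b J) {l u w : ℕ} (hl : l < p)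
    (huw : ∀ j ∈ J, ‖dworkPrime (b j) + (w : ℤ_[p])‖ ≤ ‖dworkPrime (b j) + (u : ℤ_[p])‖) :
    coefGauge a b J (l + u * p) *
        ‖coefRatio a b (l + w * p) / coefRatio a b (l + u * p) -
          coefRatio (fun i => dworkPrime (a i)) (fun i => dworkPrime (b i)) w /
            coefRatio (fun i => dworkPrime (a i)) (fun i => dworkPrime (b i)) u‖ *
        (p : ℝ)⁻¹ ^ (J.filter fun j => lastDigit (b j) ≤ l).card ≤
      gaugeIter a b J 1 w * ‖ratioDiff a b l u w‖ * (p : ℝ)⁻¹ ^ carryCount a l := by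
  have hε : 0 < (p : ℝ)⁻¹ := inv_prime_pos
  have hA := norm_pos_iff.2 (h.coefRatio_ne_zero (l + u * p))
  have hb := norm_pos_iff.2 (h.carryProd_ne_zero l w)
  have hD := h.prime.prod_norm_add_pos (J.filter fun j => lastDigit (b j) = l) u
  have hA' := h.norm_coefRatio_prime_le hl huw
  rw [h.coefRatio_div_sub_div hl.le, coefGauge, prod_norm_add_eq hl, h.card_filter_le_eq hl,
    pow_add, norm_div, norm_mul, norm_mul, norm_div, norm_div, norm_pow, norm_pow, Padic.norm_p]
  set D := ∏ j ∈ J with lastDigit (b j) = l, ‖dworkPrime (b j) + (u : ℤ_[p])‖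
  set A' := coefRatio (fun i => dworkPrime (a i)) (fun i => dworkPrime (b i))
  generalize (p : ℝ)⁻¹ = ε at hε ⊢
  calc _ = ‖A' w‖ / (‖carryProd b l w‖ * D) * (‖ratioDiff a b l u w‖ * ε ^ carryCount a l) := by
        field_simp
    _ ≤ gaugeIter a b J 1 w * (‖ratioDiff a b l u w‖ * ε ^ carryCount a l) := by
        refine mul_le_mul_of_nonneg_right ?_ (by positivity)
        rwa [div_le_iff₀ (mul_pos hb hD)]
    _ = _ := by rw [mul_assoc]

theorem gaugeIter_mul_norm_ratioDiff_mul_pow_le (h : DworkData a b J) {l s u : ℕ} (hl : l < p)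
    (hu : u < p ^ s) (n : ℕ) :
    gaugeIter a b J 1 (u + n * p ^ s) * ‖ratioDiff a b l u (u + n * p ^ s)‖ *
        (p : ℝ)⁻¹ ^ carryCount a l ≤
      (p : ℝ)⁻¹ ^ (s + 1) * gaugeIter a b J (s + 1) n *
        (p : ℝ)⁻¹ ^ (J.filter fun j => lastDigit (b j) ≤ l).card := by
  have hε : 0 < (p : ℝ)⁻¹ := inv_prime_pos
  have hΓ := h.gaugeIter_nonneg (s + 1) n
  rcases h.card_filter_lt_or_eq_zero l with hlt | ⟨hJ, ha⟩
  · calc _ ≤ (p : ℝ)⁻¹ ^ s * gaugeIter a b J (s + 1) n *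
          (p : ℝ)⁻¹ ^ ((J.filter fun j => lastDigit (b j) ≤ l).card + 1) :=
          mul_le_mul (h.gaugeIter_mul_norm_ratioDiff_le hl hu n)
            (pow_le_pow_of_le_one hε.le inv_prime_le_one hlt) (by positivity) (by positivity)
      _ = _ := by ring
  · have hb : carryCount b l = 0 := by have := h.card_filter_le_eq hl; lia
    have hdiff : ratioDiff a b l u (u + n * p ^ s) =
        unitRatio a b (l + (u + n * p ^ s) * p) - unitRatio a b (l + u * p) := by
      have ha' (v : ℕ) : carryProd a l v = 1 := by
        rw [carryProd, Finset.card_eq_zero.1 ha, Finset.prod_empty]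
      have hb' (v : ℕ) : carryProd b l v = 1 := by
        rw [carryProd, Finset.card_eq_zero.1 hb, Finset.prod_empty]
      simp only [ratioDiff, ha', hb', div_one, mul_one]
    rw [hJ, ha, hdiff, pow_zero, mul_one, mul_one, mul_comm, add_comm s 1]
    refine mul_le_mul ?_ (h.gaugeIter_le_add 1 s u n hu) (h.gaugeIter_nonneg _ _) (by positivity)
    rw [add_comm 1 s]
    exact norm_unitRatio_sub_le a b l u s n

theorem congr (h : DworkData a b J) {l s u : ℕ} (n : ℕ) (hl : l < p) (hu : u < p ^ s) :
    coefGauge a b J (l + u * p) *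
      ‖coefRatio a b (l + u * p + n * p ^ (s + 1)) / coefRatio a b (l + u * p) -
        coefRatio (fun i => dworkPrime (a i)) (fun i => dworkPrime (b i)) (u + n * p ^ s) /
          coefRatio (fun i => dworkPrime (a i)) (fun i => dworkPrime (b i)) u‖ ≤
      (p : ℝ)⁻¹ ^ (s + 1) * gaugeIter a b J (s + 1) n := by
  rw [show l + u * p + n * p ^ (s + 1) = l + (u + n * p ^ s) * p by ring]
  exact le_of_mul_le_mul_right
    ((h.coefGauge_mul_norm_sub_le hl fun j hj => h.norm_add_add_mul_pow_le hj hu n).trans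
      (h.gaugeIter_mul_norm_ratioDiff_mul_pow_le hl hu n))
    (pow_pos inv_prime_pos (J.filter fun j => lastDigit (b j) ≤ l).card)

theorem dworkChain (h : DworkData a b J) :
    DworkChain p (p : ℝ)⁻¹ (coefIter a b) (gaugeIter a b J) where
  pos := (Fact.out : p.Prime).pos
  modulus_nonneg := inv_prime_pos.le
  modulus_le_one := inv_prime_le_one
  zero _ := coefRatio_zero _ _
  ne_zero r n := (h.iter r).coefRatio_ne_zero n
  norm_le r n := (h.iter r).norm_coefRatio_le n
  gauge_le_one r n := h.gaugeIter_le_one r n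
  gauge_le_succ r l u hl := h.gaugeIter_le_succ r l u hl
  congr r s l u n hl hu := by
    simpa only [gaugeIter, coefIter, dworkIter_dworkIter, ← dworkIter_succ, ← add_assoc] using
      (h.iter r).congr n hl hu

/-- The coefficients `∏ (a_i)_n / ∏ (b_i)_n`, for the parameters replaced by their `r`-th Dwork
primes, as `p`-adic integers. -/
def coef (h : DworkData a b J) (r n : ℕ) : ℤ_[p] :=
  ⟨coefIter a b r n, h.dworkChain.norm_le_one r n⟩

theorem coef_zero (h : DworkData a b J) (r : ℕ) : h.coef r 0 = 1 :=
  Subtype.ext (h.dworkChain.zero r)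

theorem dvd_sum_range (h : DworkData a b J) {d l : ℕ} (hl : l < p ^ d) (s N : ℕ) :
    (p : ℤ_[p]) ^ (s + 1) ∣ ∑ j ∈ Finset.range (p ^ s) with j ≤ N,
      (h.coef 0 (l + (N - j) * p ^ d) * h.coef d j -
        h.coef d (N - j) * h.coef 0 (l + j * p ^ d)) := by
  rw [← norm_le_inv_pow_iff, PadicInt.coe_sum, Finset.sum_filter]
  refine (congrArg norm ?_).trans_le (h.dworkChain.norm_blockSum_subsequence_le hl s (N : ℤ))
  refine Finset.sum_congr rfl fun j _ => ?_
  rw [zero_mul, add_zero, antisymmTerm]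
  split_ifs with hj
  · rw [← Nat.cast_sub hj, extendByZero_natCast, extendByZero_natCast]
    rfl
  · rw [extendByZero_of_neg _ (by lia), extendByZero_of_neg _ (by lia)]
    simp

end DworkData

end Congruence

section Truncation

variable {R : Type*} [CommRing R]

theorem C_dvd_iff (q : R) (f : R⟦X⟧) : PowerSeries.C q ∣ f ↔ ∀ n, q ∣ coeff n f := by
  constructor
  · rintro ⟨g, rfl⟩ n
    rw [coeff_C_mul]
    exact dvd_mul_right _ _
  · intro h
    choose g hg using h
    exact ⟨PowerSeries.mk g, by ext n; rw [coeff_C_mul, coeff_mk, hg]⟩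

/-- The truncation of a power series, as a power series. -/
def truncSeries (P : ℕ) (f : R⟦X⟧) : R⟦X⟧ := (PowerSeries.trunc P f : Polynomial R)

theorem coeff_truncSeries (P : ℕ) (f : R⟦X⟧) (n : ℕ) :
    coeff n (truncSeries P f) = if n < P then coeff n f else 0 := by
  rw [truncSeries, Polynomial.coeff_coe, coeff_trunc]

theorem coeff_mul_truncSeries (f g : R⟦X⟧) (P N : ℕ) :
    coeff N (f * truncSeries P g) =
      ∑ j ∈ Finset.range P with j ≤ N, coeff (N - j) f * coeff j g := by
  have hrange : (Finset.range P).filter (· ≤ N) = (Finset.range N.succ).filter (· < P) := by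
    ext j
    simp only [Finset.mem_filter, Finset.mem_range]
    lia
  rw [mul_comm, coeff_mul, Finset.Nat.sum_antidiagonal_eq_sum_range_succ (fun i j =>
    coeff i (truncSeries P g) * coeff j f), hrange, Finset.sum_filter]
  refine Finset.sum_congr rfl fun j _ => ?_
  rw [coeff_truncSeries, ite_mul, zero_mul, mul_comm]

theorem isUnit_of_coeff_zero {f : R⟦X⟧} (hf : coeff 0 f = 1) : IsUnit f := by
  rw [coeff_zero_eq_constantCoeff_apply] at hf
  rw [PowerSeries.isUnit_iff_constantCoeff, hf]
  exact isUnit_one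

theorem isUnit_truncSeries {f : R⟦X⟧} {P : ℕ} (hP : 0 < P) (hf : coeff 0 f = 1) :
    IsUnit (truncSeries P f) :=
  isUnit_of_coeff_zero (by rw [coeff_truncSeries, if_pos hP, hf])

/-- The generating series of the terms of `A` along the arithmetic progression `l, l + D, …`. -/
def progSeries (A : ℕ → R) (D l : ℕ) : R⟦X⟧ := PowerSeries.mk fun j => A (l + j * D)

/-- Dwork's congruences between the progressions of step `D` in `A` and the sequence `C`: modulo
`q`, the series `progSeries A D l` and `∑ C_j t^j` have the same quotients by their truncations
at `P`. -/
def ProgCongr (q : R) (P D : ℕ) (A C : ℕ → R) : Prop :=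
  ∀ l < D, ∀ N, q ∣ ∑ j ∈ Finset.range P with j ≤ N,
    (A (l + (N - j) * D) * C j - C (N - j) * A (l + j * D))

theorem ProgCongr.C_dvd {A C : ℕ → R} {q : R} {P D : ℕ} (h : ProgCongr q P D A C) {l : ℕ}
    (hl : l < D) :
    PowerSeries.C q ∣ progSeries A D l * truncSeries P (PowerSeries.mk C) -
      PowerSeries.mk C * truncSeries P (progSeries A D l) := by
  rw [C_dvd_iff]
  intro N
  rw [map_sub, coeff_mul_truncSeries, coeff_mul_truncSeries, ← Finset.sum_sub_distrib]
  simpa only [progSeries, coeff_mk] using h l hl N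

theorem ProgCongr.C_dvd_progSeries {A C : ℕ → R} {q : R} {P D : ℕ} (h : ProgCongr q P D A C)
    (hP : 0 < P) (hC : C 0 = 1) {l l' : ℕ} (hl : l < D) (hl' : l' < D) :
    PowerSeries.C q ∣ progSeries A D l * truncSeries P (progSeries A D l') -
      progSeries A D l' * truncSeries P (progSeries A D l) := by
  set Ψ : R⟦X⟧ := PowerSeries.mk C with hΨ
  have hΨ0 : coeff 0 Ψ = 1 := by rw [hΨ, coeff_mk, hC]
  refine ((isUnit_of_coeff_zero hΨ0).mul (isUnit_truncSeries hP hΨ0)).dvd_mul_left.1 ?_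
  have hcombine : Ψ * truncSeries P Ψ * (progSeries A D l * truncSeries P (progSeries A D l') -
      progSeries A D l' * truncSeries P (progSeries A D l)) =
      Ψ * truncSeries P (progSeries A D l') *
          (progSeries A D l * truncSeries P Ψ - Ψ * truncSeries P (progSeries A D l)) -
        Ψ * truncSeries P (progSeries A D l) *
          (progSeries A D l' * truncSeries P Ψ - Ψ * truncSeries P (progSeries A D l')) := by
    ring
  rw [hcombine]
  exact dvd_sub ((h.C_dvd hl).mul_left _) ((h.C_dvd hl').mul_left _)

theorem sum_filter_mod_eq (A : ℕ → R) (P : ℕ) {D l l' : ℕ} (K : ℕ) (hl : l < D) (hl' : l' < D) :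
    ∑ i ∈ (Finset.range (P * D)).filter (fun i => i ≤ l + l' + K * D) with i % D = l,
        A i * A (l + l' + K * D - i) =
      coeff K (progSeries A D l' * truncSeries P (progSeries A D l)) := by
  rw [coeff_mul_truncSeries, Finset.sum_filter, Finset.sum_filter, Finset.sum_filter, mul_comm P,
    sum_range_eq_sum_blocks]
  refine Finset.sum_congr rfl fun j _ => ?_
  rw [Finset.sum_eq_single_of_mem l (Finset.mem_range.2 hl)]
  · have hle : l + j * D ≤ l + l' + K * D ↔ j ≤ K := by
      constructor
      · intro hj
        refine Nat.lt_succ_iff.1 (Nat.lt_of_mul_lt_mul_right (a := D) ?_)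
        rw [Nat.succ_mul]
        lia
      · intro hj
        have := Nat.mul_le_mul_right D hj
        lia
    rw [Nat.add_mul_mod_self_right, Nat.mod_eq_of_lt hl, if_pos rfl]
    refine if_congr hle rfl rfl |>.trans (if_ctx_congr Iff.rfl (fun hj => ?_) fun _ => rfl)
    have := Nat.mul_le_mul_right D hj
    rw [progSeries, progSeries, coeff_mk, coeff_mk, mul_comm,
      show l + l' + K * D - (l + j * D) = l' + (K - j) * D by rw [Nat.sub_mul]; lia]
  · intro i hi hne
    rw [Nat.add_mul_mod_self_right, Nat.mod_eq_of_lt (Finset.mem_range.1 hi), if_neg hne, ite_self]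

theorem sub_mod_eq_iff {D l l' i K : ℕ} (hl : l < D) (hl' : l' < D)
    (hi : i ≤ l + l' + K * D) : (l + l' + K * D - i) % D = l ↔ i % D = l' := by
  calc (l + l' + K * D - i) % D = l ↔ l + l' + K * D - i ≡ l [MOD D] := by
        rw [Nat.ModEq, Nat.mod_eq_of_lt hl]
    _ ↔ i + (l + l' + K * D - i) ≡ i + l [MOD D] := (Nat.ModEq.add_iff_left rfl).symm
    _ ↔ l' + l ≡ i + l [MOD D] := by
        rw [Nat.add_sub_cancel' hi, Nat.ModEq, Nat.add_mul_mod_self_right, add_comm l, Nat.ModEq]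
    _ ↔ i % D = l' := by
        rw [Nat.ModEq.add_iff_right rfl, Nat.ModEq, Nat.mod_eq_of_lt hl', eq_comm]

theorem ProgCongr.dvd_sum_mod_sub_sum_mod {A C : ℕ → R} {q : R} {P D : ℕ}
    (h : ProgCongr q P D A C) (hP : 0 < P) (hC : C 0 = 1) {l : ℕ} (hl : l < D) (N : ℕ) :
    q ∣ ∑ i ∈ (Finset.range (P * D)).filter (fun i => i ≤ N) with (N - i) % D = l,
        A i * A (N - i) -
      ∑ i ∈ (Finset.range (P * D)).filter (fun i => i ≤ N) with i % D = l, A i * A (N - i) := by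
  rcases lt_or_ge N l with hN | hN
  · rw [Finset.sum_eq_zero, Finset.sum_eq_zero, sub_zero]
    · exact dvd_zero q
    · intro i hi
      have := Nat.mod_le i D
      simp only [Finset.mem_filter] at hi
      lia
    · intro i hi
      have := Nat.mod_le (N - i) D
      simp only [Finset.mem_filter] at hi
      lia
  · obtain ⟨l', K, hl', rfl⟩ : ∃ l' K, l' < D ∧ N = l + l' + K * D := by
      refine ⟨(N - l) % D, (N - l) / D, Nat.mod_lt _ (by lia), ?_⟩
      have := Nat.mod_add_div' (N - l) D
      lia
    rw [sum_filter_mod_eq A P K hl hl', Finset.filter_congr fun i hi =>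
      sub_mod_eq_iff hl hl' (Finset.mem_filter.1 hi).2, add_comm l l',
      sum_filter_mod_eq A P K hl' hl, ← map_sub]
    exact (C_dvd_iff _ _).1 (h.C_dvd_progSeries hP hC hl hl') K

theorem sum_mul_comp_eq {ι : Type*} (S : Finset ι) (f : ι → R) (g : ι → ℕ) (D : ℕ)
    (hg : ∀ i ∈ S, g i < D) (δ : ℕ → R) :
    ∑ i ∈ S, f i * δ (g i) = ∑ l ∈ Finset.range D, δ l * ∑ i ∈ S with g i = l, f i := by
  rw [← Finset.sum_fiberwise_of_maps_to (t := Finset.range D) (g := g)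
    (fun i hi => Finset.mem_range.2 (hg i hi))]
  refine Finset.sum_congr rfl fun l _ => ?_
  rw [Finset.mul_sum]
  refine Finset.sum_congr rfl fun i hi => ?_
  rw [(Finset.mem_filter.1 hi).2, mul_comm]

theorem dvd_two_mul_sum_mul_sub {q q' : R} {S : Finset ℕ} {D N : ℕ} (hD : 0 < D)
    (f δ : ℕ → R) (hδ : ∀ l, q ∣ 2 * δ l)
    (hf : ∀ l < D, q' ∣ ∑ i ∈ S with (N - i) % D = l, f i - ∑ i ∈ S with i % D = l, f i) :
    q * q' ∣ 2 * ∑ i ∈ S, f i * (δ ((N - i) % D) - δ (i % D)) := by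
  simp only [mul_sub, Finset.sum_sub_distrib]
  rw [← mul_sub, sum_mul_comp_eq S f _ D (fun _ _ => Nat.mod_lt _ hD),
    sum_mul_comp_eq S f _ D (fun _ _ => Nat.mod_lt _ hD), ← Finset.sum_sub_distrib, Finset.mul_sum]
  refine Finset.dvd_sum fun l hl => ?_
  rw [← mul_sub, ← mul_assoc]
  exact mul_dvd_mul (hδ l) (hf l (Finset.mem_range.1 hl))

/-- Congruence of the function `α` modulo powers of `p` up to a factor `2`, which is lost for
`p = 2` only. -/
def TwiceCongr (p : ℕ) (α : ℕ → R) : Prop :=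
  ∀ k x y, x ≡ y [MOD p ^ k] → (p : R) ^ k ∣ 2 * (α x - α y)

-- Replacing `α` by its reductions `α (· % p ^ k)`, the sum telescopes over `k`.
theorem TwiceCongr.pow_dvd_two_mul_sum {p : ℕ} {α : ℕ → R} (hα : TwiceCongr p α) (hp : 0 < p)
    {f : ℕ → R} {S : Finset ℕ} {n N : ℕ}
    (hf : ∀ k ≤ n, ∀ l < p ^ k, (p : R) ^ (n - k + 1) ∣
      ∑ i ∈ S with (N - i) % p ^ k = l, f i - ∑ i ∈ S with i % p ^ k = l, f i) :
    (p : R) ^ n ∣ 2 * ∑ i ∈ S, f i * (α (N - i) - α i) := by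
  have hreduce : ∀ k ≤ n,
      (p : R) ^ n ∣ 2 * ∑ i ∈ S, f i * (α ((N - i) % p ^ k) - α (i % p ^ k)) := by
    intro k hk
    induction k with
    | zero => simp [Nat.mod_one]
    | succ k ih =>
      have hmod (x : ℕ) : x % p ^ (k + 1) % p ^ k = x % p ^ k :=
        Nat.mod_mod_of_dvd _ (pow_dvd_pow p (Nat.le_succ k))
      have hstep := dvd_two_mul_sum_mul_sub (pow_pos hp (k + 1)) f (fun l => α l - α (l % p ^ k))
        (fun l => hα k _ _ (Nat.mod_modEq l _).symm) (hf (k + 1) hk)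
      rw [← pow_add, show k + (n - (k + 1) + 1) = n by lia] at hstep
      convert dvd_add hstep (ih (by lia)) using 1
      rw [← mul_add, ← Finset.sum_add_distrib]
      simp only [hmod, ← mul_add]
      congr! 3
      ring
  have hlast : (p : R) ^ n ∣ ∑ i ∈ S, f i * (2 * (α (N - i) - α ((N - i) % p ^ n)) -
      2 * (α i - α (i % p ^ n))) :=
    Finset.dvd_sum fun i _ => (dvd_sub (hα n _ _ (Nat.mod_modEq _ _).symm)
      (hα n _ _ (Nat.mod_modEq _ _).symm)).mul_left _
  convert dvd_add (hreduce n le_rfl) hlast using 1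
  rw [Finset.mul_sum, Finset.mul_sum, ← Finset.sum_add_distrib]
  exact Finset.sum_congr rfl fun i _ => by ring

theorem TwiceCongr.C_pow_dvd_two_mul {p : ℕ} {A α : ℕ → R} (hα : TwiceCongr p α) (hp : 0 < p)
    {C : ℕ → ℕ → R} (hC : ∀ d, C d 0 = 1)
    (h : ∀ d s, ProgCongr ((p : R) ^ (s + 1)) (p ^ s) (p ^ d) A (C d)) (n : ℕ) :
    PowerSeries.C ((p : R) ^ n) ∣
      2 * ((PowerSeries.mk fun i => A i * α i) * truncSeries (p ^ n) (PowerSeries.mk A) -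
        PowerSeries.mk A * truncSeries (p ^ n) (PowerSeries.mk fun i => A i * α i)) := by
  rw [C_dvd_iff]
  intro N
  have htwo : (2 : R⟦X⟧) = PowerSeries.C 2 := (map_ofNat _ 2).symm
  rw [htwo, coeff_C_mul, map_sub, coeff_mul_truncSeries, coeff_mul_truncSeries,
    ← Finset.sum_sub_distrib]
  simp only [coeff_mk]
  have hsum := hα.pow_dvd_two_mul_sum hp (f := fun i => A i * A (N - i))
    (S := (Finset.range (p ^ n)).filter (· ≤ N)) (n := n) (N := N) fun d hd l hl => by
      have := (h d (n - d)).dvd_sum_mod_sub_sum_mod (pow_pos hp (n - d)) (hC d) hl N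
      rwa [← pow_add, Nat.sub_add_cancel hd] at this
  convert hsum using 4
  ring

end Truncation

section Digamma

variable {p : ℕ} [Fact p.Prime]

theorem natCast_dvd_natCast_iff (n : ℕ) : (p : ℤ_[p]) ∣ n ↔ p ∣ n := by
  rw [← PadicInt.norm_lt_one_iff_dvd, PadicInt.norm_natCast_lt_one_iff]

theorem coe_unitInv_natCast (n : ℕ) :
    (unitInv (n : ℤ_[p]) : ℚ_[p]) = if p ∣ n then 0 else 1 / (n : ℚ_[p]) := by
  split_ifs with h
  · rw [unitInv, if_pos ((natCast_dvd_natCast_iff n).2 h)]; rfl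
  · have hinv : (n : ℚ_[p]) * (unitInv (n : ℤ_[p]) : ℚ_[p]) = 1 := by
      exact_mod_cast congrArg ((↑) : ℤ_[p] → ℚ_[p])
        (mul_unitInv (mt (natCast_dvd_natCast_iff n).1 h))
    rw [eq_div_iff (left_ne_zero_of_mul_eq_one hinv), mul_comm, hinv]

theorem sum_inv_eq_unitHarmonic (n : ℕ) :
    ∑ k ∈ (Finset.Ico 1 n).filter (fun k => ¬ p ∣ k), (1 / (k : ℚ_[p])) =
      (unitHarmonic (1 : ℤ_[p]) (n - 1) : ℚ_[p]) := by
  rw [Finset.sum_filter, Finset.sum_Ico_eq_sum_range, unitHarmonic, PadicInt.coe_sum]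
  refine Finset.sum_congr rfl fun i _ => ?_
  have hinv := coe_unitInv_natCast (p := p) (1 + i)
  push_cast at hinv
  rw [hinv]
  by_cases h : p ∣ 1 + i <;> simp [h]

theorem pow_dvd_two_mul_unitHarmonic_sub {w : ℕ} (hw : w ≠ 0) {m n : ℕ}
    (h : (p : ℤ_[p]) ^ w ∣ (m : ℤ_[p]) - n) :
    (p : ℤ_[p]) ^ w ∣ 2 * (unitHarmonic (1 : ℤ_[p]) m - unitHarmonic 1 n) := by
  wlog hmn : n ≤ m generalizing m n
  · have hswap := this (m := n) (n := m) ((dvd_sub_comm).1 h) (by lia)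
    rwa [← dvd_neg, ← mul_neg, neg_sub] at hswap
  obtain ⟨d, rfl⟩ := Nat.exists_eq_add_of_le hmn
  rw [unitHarmonic_add, add_sub_cancel_left]
  refine dvd_two_mul_unitHarmonic (dvd_pow_self _ hw) (pow_ne_zero _ PadicInt.prime_p.ne_zero) ?_ _
  simpa using h

theorem neBot_comap_natCast (z : ℤ_[p]) :
    (comap (fun n : ℕ => (n : ℤ_[p])) (𝓝 z) ⊓ 𝓟 {n | 0 < n}).NeBot := by
  rw [inf_principal_neBot_iff]
  rintro U ⟨t, ht, hU⟩
  obtain ⟨ε, hε, hball⟩ := Metric.mem_nhds_iff.1 ht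
  obtain ⟨w, hw⟩ := PadicInt.exists_pow_neg_lt p hε
  obtain ⟨n, hn⟩ := exists_nat_dvd_sub (pow_ne_zero w PadicInt.prime_p.ne_zero) z
  have hp : 0 < p := (Fact.out : p.Prime).pos
  refine ⟨n + p ^ w, hU (hball ?_), Nat.add_pos_right _ (pow_pos hp w)⟩
  rw [Metric.mem_ball, dist_comm, dist_eq_norm]
  refine lt_of_le_of_lt ?_ hw
  rw [PadicInt.norm_le_pow_iff_mem_span_pow, Ideal.mem_span_singleton]
  beta_reduce
  rw [Nat.cast_add, ← sub_sub, Nat.cast_pow]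
  exact dvd_sub hn dvd_rfl

theorem eventually_pow_dvd_sub (z : ℤ_[p]) (w : ℕ) :
    ∀ᶠ n : ℕ in comap (fun n : ℕ => (n : ℤ_[p])) (𝓝 z) ⊓ 𝓟 {n | 0 < n},
      0 < n ∧ (p : ℤ_[p]) ^ w ∣ z - n := by
  have hnhds : {x : ℤ_[p] | (p : ℤ_[p]) ^ w ∣ z - x} ∈ 𝓝 z := by
    have hpos : (0 : ℝ) < (p : ℝ) ^ (-(w : ℤ)) :=
      zpow_pos (by exact_mod_cast (Fact.out : p.Prime).pos) _
    refine mem_of_superset (Metric.ball_mem_nhds z hpos) fun x hx => ?_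
    rw [Metric.mem_ball, dist_comm, dist_eq_norm] at hx
    exact Ideal.mem_span_singleton.1 ((PadicInt.norm_le_pow_iff_mem_span_pow _ w).1 hx.le)
  exact inter_mem (mem_inf_of_right (mem_principal_self _))
    (mem_inf_of_left (preimage_mem_comap hnhds))

theorem exists_tendsto_unitHarmonic (z : ℤ_[p]) :
    ∃ x : ℚ_[p], Tendsto (fun n : ℕ => (unitHarmonic (1 : ℤ_[p]) (n - 1) : ℚ_[p]))
      (comap (fun n : ℕ => (n : ℤ_[p])) (𝓝 z) ⊓ 𝓟 {n | 0 < n}) (𝓝 x) := by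
  have := neBot_comap_natCast z
  rw [← cauchy_map_iff_exists_tendsto, Metric.cauchy_iff]
  refine ⟨inferInstance, fun ε hε => ?_⟩
  have h2 : 0 < ‖(2 : ℚ_[p])‖ := norm_pos_iff.2 two_ne_zero
  obtain ⟨w, hw⟩ := PadicInt.exists_pow_neg_lt p (mul_pos h2 hε)
  refine ⟨_, image_mem_map (eventually_pow_dvd_sub z (w + 1)), ?_⟩
  rintro _ ⟨m, ⟨hm, hm'⟩, rfl⟩ _ ⟨n, ⟨hn, hn'⟩, rfl⟩
  have hmn : (p : ℤ_[p]) ^ (w + 1) ∣ ((m - 1 : ℕ) : ℤ_[p]) - ((n - 1 : ℕ) : ℤ_[p]) := by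
    rw [Nat.cast_sub hm, Nat.cast_sub hn, sub_sub_sub_cancel_right]
    simpa using dvd_sub hn' hm'
  have hclose := (norm_le_inv_pow_iff _ _).2
    (pow_dvd_two_mul_unitHarmonic_sub (Nat.succ_ne_zero w) hmn)
  push_cast at hclose
  rw [norm_mul] at hclose
  rw [dist_eq_norm]
  refine lt_of_mul_lt_mul_left (hclose.trans_lt (lt_of_le_of_lt ?_ hw)) h2.le
  rw [zpow_neg, zpow_natCast, ← inv_pow]
  exact pow_le_pow_of_le_one inv_prime_pos.le inv_prime_le_one (Nat.le_succ w)

theorem psiTilde_spec (z : ℤ_[p]) : ∃ x : ℤ_[p], psiTilde z = x ∧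
    ∀ w : ℕ, ∃ n : ℕ, (p : ℤ_[p]) ^ w ∣ z - (1 + n) ∧ (p : ℤ_[p]) ^ w ∣ x - unitHarmonic 1 n := by
  have hne := neBot_comap_natCast z
  obtain ⟨x, hx⟩ := exists_tendsto_unitHarmonic z
  have hx1 : ‖x‖ ≤ 1 :=
    le_of_tendsto hx.norm (Eventually.of_forall fun n => PadicInt.norm_le_one _)
  refine ⟨⟨x, hx1⟩, ?_, fun w => ?_⟩
  · simp only [psiTilde, sum_inv_eq_unitHarmonic]
    exact hx.limUnder_eq
  · have hpos : 0 < (p : ℝ)⁻¹ ^ w := pow_pos inv_prime_pos w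
    obtain ⟨n, ⟨hn, hzn⟩, hxn⟩ :=
      ((eventually_pow_dvd_sub z w).and (hx (Metric.ball_mem_nhds x hpos))).exists
    refine ⟨n - 1, ?_, ?_⟩
    · rw [Nat.cast_sub hn]; simpa using hzn
    · rw [← norm_le_inv_pow_iff]
      simp only [Metric.mem_ball, dist_comm _ x, dist_eq_norm] at hxn
      exact hxn.le

/-- `psiTilde` as a `p`-adic integer. -/
def psiInt (z : ℤ_[p]) : ℤ_[p] := (psiTilde_spec z).choose

theorem coe_psiInt (z : ℤ_[p]) : (psiInt z : ℚ_[p]) = psiTilde z :=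
  (psiTilde_spec z).choose_spec.1.symm

theorem exists_pow_dvd {d : ℤ_[p]} (hd : d ≠ 0) : ∃ w : ℕ, w ≠ 0 ∧ d ∣ (p : ℤ_[p]) ^ w := by
  refine ⟨d.valuation + 1, Nat.succ_ne_zero _, ?_⟩
  conv_lhs => rw [PadicInt.unitCoeff_spec hd]
  exact Units.mul_left_dvd.2 (pow_dvd_pow _ (Nat.le_succ _))

theorem sq_dvd_unitProd_sub {M : ℕ} (hM : p ∣ M) (z : ℤ_[p]) :
    (M : ℤ_[p]) ^ 2 ∣ unitProd z M - unitProd 1 M * (1 + (M : ℤ_[p]) * psiInt z) := by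
  rcases eq_or_ne M 0 with rfl | hM0
  · simp [unitProd]
  obtain ⟨w, hw, hd⟩ := exists_pow_dvd (d := (M : ℤ_[p]) ^ 2) (by simpa using hM0)
  obtain ⟨n, hzn, hψ⟩ := (psiTilde_spec z).choose_spec.2 w
  have hleft := hd.trans (unitProd_congr_left (dvd_pow_self _ hw) hzn M)
  convert dvd_sub (dvd_add hleft (sq_dvd_unitProd_one_add hM n))
    ((hd.trans hψ).mul_left (unitProd 1 M * (M : ℤ_[p]))) using 1
  rw [psiInt]
  ring

end Digamma

section InvRatio

variable {p : ℕ} [Fact p.Prime] {ι : Type*} [Fintype ι]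

/-- The product of the units `unitProd (a i) M`. -/
def unitProds (a : ι → ℤ_[p]) (M : ℕ) : ℤ_[p] := ∏ i, unitProd (a i) M

theorem isUnit_unitProds (a : ι → ℤ_[p]) (M : ℕ) : IsUnit (unitProds a M) :=
  IsUnit.prod_iff.2 fun i _ => isUnit_unitProd (a i) M

/-- The inverse of `unitRatio`, as a `p`-adic integer. -/
def invRatio (a b : ι → ℤ_[p]) (M : ℕ) : ℤ_[p] := unitProds b M * (unitProds a M).inv

theorem mul_invRatio (a b : ι → ℤ_[p]) (M : ℕ) :
    unitProds a M * invRatio a b M = unitProds b M := by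
  have h := PadicInt.mul_inv (PadicInt.isUnit_iff.1 (isUnit_unitProds a M))
  rw [invRatio]
  linear_combination unitProds b M * h

theorem unitRatio_mul_invRatio (a b : ι → ℤ_[p]) (M : ℕ) :
    unitRatio a b M * (invRatio a b M : ℚ_[p]) = 1 := by
  have h := congrArg ((↑) : ℤ_[p] → ℚ_[p]) (mul_invRatio a b M)
  simp only [PadicInt.coe_mul, unitProds, coe_prod] at h
  have hb : ∏ i, (unitProd (b i) M : ℚ_[p]) ≠ 0 := by
    rw [← coe_prod]
    exact PadicInt.coe_ne_zero.2 (isUnit_unitProds b M).ne_zero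
  rw [unitRatio, div_mul_eq_mul_div, h, div_self hb]

theorem dvd_invRatio_sub_one (a b : ι → ℤ_[p]) {M : ℕ} (hM : p ∣ M) :
    (M : ℤ_[p]) ∣ invRatio a b M - 1 := by
  rcases eq_or_ne M 0 with rfl | hM0
  · have h := mul_invRatio a b 0
    simp only [unitProds, unitProd, Finset.range_zero, Finset.prod_empty, Finset.prod_const_one,
      one_mul] at h
    simp [h]
  have hM' : (M : ℤ_[p]) ≠ 0 := by exact_mod_cast hM0
  refine (isUnit_unitProds a M).dvd_mul_left.1 ?_
  rw [mul_sub, mul_invRatio, mul_one]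
  exact dvd_prod_sub_prod _ _ _ _ fun i _ =>
    dvd_unitProd_sub ((natCast_dvd_natCast_iff M).2 hM) hM' dvd_rfl _ _

theorem sq_dvd_unitProds_sub (a : ι → ℤ_[p]) {M : ℕ} (hM : p ∣ M) :
    (M : ℤ_[p]) ^ 2 ∣ unitProds a M -
      unitProd 1 M ^ Fintype.card ι * (1 + (M : ℤ_[p]) * ∑ i, psiInt (a i)) := by
  have hfactors : (M : ℤ_[p]) ^ 2 ∣ unitProds a M -
      ∏ i, (unitProd 1 M * (1 + (M : ℤ_[p]) * psiInt (a i))) :=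
    dvd_prod_sub_prod _ _ _ _ fun i _ => sq_dvd_unitProd_sub hM (a i)
  have hexpand := sq_dvd_prod_one_add_sub (M : ℤ_[p]) Finset.univ fun i => psiInt (a i)
  rw [Finset.prod_mul_distrib, Finset.prod_const, Finset.card_univ] at hfactors
  convert dvd_add hfactors (hexpand.mul_left (unitProd 1 M ^ Fintype.card ι)) using 1
  ring

theorem sq_dvd_invRatio_sub (a b : ι → ℤ_[p]) {M : ℕ} (hM : p ∣ M) :
    (M : ℤ_[p]) ^ 2 ∣ invRatio a b M -
      (1 - (M : ℤ_[p]) * (∑ i, psiInt (a i) - ∑ i, psiInt (b i))) := by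
  refine (isUnit_unitProds a M).dvd_mul_left.1 ?_
  obtain ⟨x, hx⟩ := sq_dvd_unitProds_sub a hM
  obtain ⟨y, hy⟩ := sq_dvd_unitProds_sub b hM
  have h := mul_invRatio a b M
  set u := unitProd (1 : ℤ_[p]) M ^ Fintype.card ι
  set s := ∑ i, psiInt (a i)
  set t := ∑ i, psiInt (b i)
  refine ⟨y - x * (1 - M * (s - t)) + u * s * (s - t), ?_⟩
  linear_combination h + hy - (1 - (M : ℤ_[p]) * (s - t)) * hx

theorem mul_dvd_unitProds_add (a : ι → ℤ_[p]) {M N : ℕ} (hM : p ∣ M) (hN : p ∣ N) :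
    (M * N : ℤ_[p]) ∣ 2 * (unitProds a (M + N) - unitProds a M * unitProds a N) := by
  rw [unitProds, unitProds, unitProds, ← Finset.prod_mul_distrib]
  exact dvd_mul_prod_sub_prod _ _ _ _ _ fun i _ => mul_dvd_unitProd_add hM hN (a i)

theorem mul_dvd_invRatio_add (a b : ι → ℤ_[p]) {M N : ℕ} (hM : p ∣ M) (hN : p ∣ N) :
    (M * N : ℤ_[p]) ∣ 2 * (invRatio a b (M + N) - invRatio a b M * invRatio a b N) := by
  refine (isUnit_unitProds a (M + N)).dvd_mul_left.1 ?_
  obtain ⟨x, hx⟩ := mul_dvd_unitProds_add a hM hN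
  obtain ⟨y, hy⟩ := mul_dvd_unitProds_add b hM hN
  refine ⟨y - x * (invRatio a b M * invRatio a b N), ?_⟩
  linear_combination 2 * mul_invRatio a b (M + N) + hy -
    (invRatio a b M * invRatio a b N) * hx -
    2 * unitProds a N * invRatio a b N * mul_invRatio a b M -
    2 * unitProds b M * mul_invRatio a b N

end InvRatio

section PadicEstimates

variable {p : ℕ} [Fact p.Prime]

theorem exists_unit_natCast_eq {n : ℕ} (hn : n ≠ 0) :
    ∃ u : ℤ_[p]ˣ, (n : ℤ_[p]) = p ^ padicValNat p n * u := by
  have hn' : (n : ℤ_[p]) ≠ 0 := by exact_mod_cast hn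
  refine ⟨PadicInt.unitCoeff hn', ?_⟩
  have hval : (n : ℤ_[p]).valuation = padicValNat p n := by
    have h := PadicInt.valuation_coe (n : ℤ_[p])
    rw [PadicInt.coe_natCast, Padic.valuation_natCast] at h
    exact_mod_cast h.symm
  rw [← hval, mul_comm]
  exact PadicInt.unitCoeff_spec hn'

theorem two_mul_padicValNat_le {n : ℕ} (hn : n ≠ 0) : 2 * padicValNat p n ≤ n :=
  calc
    2 * padicValNat p n ≤ 2 ^ padicValNat p n := Nat.mul_le_pow (by decide) _
    _ ≤ p ^ padicValNat p n := Nat.pow_le_pow_left (Fact.out : p.Prime).two_le _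
    _ ≤ n := Nat.le_of_dvd (Nat.pos_of_ne_zero hn) pow_padicValNat_dvd

theorem exists_pow_div_succ (k : ℕ) : ∃ q : ℤ_[p], ((k + 1 : ℕ) : ℤ_[p]) * q = p ^ k ∧
    ∀ B, 2 * B + 1 ≤ k → (p : ℤ_[p]) ^ B ∣ q := by
  obtain ⟨u, hk⟩ := exists_unit_natCast_eq (p := p) (Nat.succ_ne_zero k)
  have hv := two_mul_padicValNat_le (p := p) (Nat.succ_ne_zero k)
  set v := padicValNat p (k + 1)
  refine ⟨p ^ (k - v) * (u⁻¹ : ℤ_[p]ˣ), ?_, fun B hB => (pow_dvd_pow _ (by lia)).mul_right _⟩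
  rw [hk, mul_mul_mul_comm, Units.mul_inv, mul_one, ← pow_add]
  congr 1
  lia

theorem factorial_mul_sq_dvd {k : ℕ} (hk : 2 ≤ k) :
    ((k.factorial : ℕ) : ℤ_[p]) * p ^ 2 ∣ 2 * p ^ k := by
  have hp : p.Prime := Fact.out
  obtain ⟨u, hu⟩ := exists_unit_natCast_eq (p := p) (Nat.factorial_ne_zero k)
  have hv := sub_one_mul_padicValNat_factorial_lt_of_ne_zero p (by lia : k ≠ 0)
  set v := padicValNat p k.factorial
  rw [hu, mul_right_comm, ← pow_add, Units.mul_right_dvd]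
  rcases hp.eq_two_or_odd' with rfl | hodd
  · have h := pow_dvd_pow ((2 : ℕ) : ℤ_[2]) (by lia : v + 2 ≤ k + 1)
    rw [pow_succ' _ k] at h
    exact_mod_cast h
  · have hp2 : 2 ≤ p - 1 := by
      have := hp.two_le
      rcases hodd with ⟨t, ht⟩
      lia
    have h2v : 2 * v ≤ (p - 1) * v := Nat.mul_le_mul_right _ hp2
    exact (pow_dvd_pow _ (by lia)).mul_left _

/-- The difference between the `k`-th term of `(1 + pw)^m - 1` and that of `m log(1 + pw)` is
divisible by `(pm)^2`, up to a factor `2`. -/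
theorem sq_dvd_two_mul_choose_sub (m k : ℕ) {q : ℤ_[p]}
    (hq : ((k + 1 : ℕ) : ℤ_[p]) * q = p ^ k) :
    ((p * m : ℕ) : ℤ_[p]) ^ 2 ∣
      2 * (p ^ (k + 1) * (m.choose (k + 1) : ℕ) - (p * m : ℕ) * ((-1) ^ k * q)) := by
  rcases Nat.eq_zero_or_pos k with rfl | hk
  · have : q = 1 := by simpa using hq
    simp [this]
  have hf0 : (((k + 1).factorial : ℕ) : ℤ_[p]) ≠ 0 := by
    exact_mod_cast Nat.factorial_ne_zero (k + 1)
  have hchoose : (((k + 1).factorial : ℕ) : ℤ_[p]) * (m.choose (k + 1) : ℕ) =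
      m * ∏ i ∈ Finset.range k, ((m : ℤ_[p]) - (i + 1 : ℕ)) := by
    rw [← Nat.cast_mul, ← Nat.descFactorial_eq_factorial_mul_choose,
      ← descPochhammer_eval_eq_descFactorial, descPochhammer_eval_eq_prod_range,
      Finset.prod_range_succ']
    simp [mul_comm]
  have hlog : (((k + 1).factorial : ℕ) : ℤ_[p]) * ((-1) ^ k * q) =
      p ^ k * ∏ i ∈ Finset.range k, (-((i + 1 : ℕ) : ℤ_[p])) := by
    rw [Finset.prod_neg, Finset.card_range, ← Nat.cast_prod, Finset.prod_range_add_one_eq_factorial,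
      Nat.factorial_succ, ← hq]
    push_cast
    ring
  obtain ⟨z, hz⟩ : (m : ℤ_[p]) ∣ ∏ i ∈ Finset.range k, ((m : ℤ_[p]) - (i + 1 : ℕ)) -
      ∏ i ∈ Finset.range k, (-((i + 1 : ℕ) : ℤ_[p])) :=
    dvd_prod_sub_prod _ _ _ _ fun i _ => ⟨1, by ring⟩
  obtain ⟨y, hy⟩ := factorial_mul_sq_dvd (p := p) (k := k + 1) (by lia)
  refine ⟨y * z, mul_left_cancel₀ hf0 ?_⟩
  push_cast at hchoose hlog hz hy ⊢
  linear_combination 2 * (p : ℤ_[p]) ^ (k + 1) * hchoose - 2 * p * m * hlog +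
    2 * (p : ℤ_[p]) ^ (k + 1) * m * hz + (m : ℤ_[p]) ^ 2 * z * hy

theorem dvd_pow_mul_choose (m k : ℕ) :
    ((p * m : ℕ) : ℤ_[p]) ∣ p ^ (k + 1) * (m.choose (k + 1) : ℕ) := by
  obtain ⟨q, hq, -⟩ := exists_pow_div_succ (p := p) k
  rcases m with _ | m
  · simp
  have h := congrArg (Nat.cast (R := ℤ_[p])) (Nat.add_one_mul_choose_eq m k)
  refine ⟨q * (m.choose k : ℕ), ?_⟩
  push_cast at h hq ⊢
  linear_combination (-(p : ℤ_[p]) * q) * h - p * ((m + 1).choose (k + 1) : ℤ_[p]) * hq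

end PadicEstimates

section Log

variable {p : ℕ} [Fact p.Prime]

theorem qpToK_coe (x : ℤ_[p]) : qpToK p (x : ℚ_[p]) = algebraMap (W p) (K p) (zpToW p x) :=
  IsFractionRing.lift_algebraMap (A := ℤ_[p]) (K := ℚ_[p])
    (g := (algebraMap (W p) (K p)).comp (zpToW p))
    ((IsFractionRing.injective (W p) (K p)).comp (zpToW_injective p)) x

instance charZero_K : CharZero (K p) := charZero_of_injective_ringHom (qpToK p).injective

instance charZero_W : CharZero (W p) := charZero_of_injective_ringHom (zpToW_injective p)

theorem pow_dvd_zpToW {n : ℕ} {x : ℤ_[p]} (h : (p : ℤ_[p]) ^ n ∣ x) :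
    (p : W p) ^ n ∣ zpToW p x := by
  simpa only [map_pow, map_natCast] using map_dvd (zpToW p) h

theorem isUnit_natCast_W {x : ℕ} (hx : ¬ p ∣ x) : IsUnit (x : W p) := by
  have hunit : IsUnit (x : ℤ_[p]) := isUnit_of_not_dvd (mt (natCast_dvd_natCast_iff x).1 hx)
  simpa only [map_natCast] using hunit.map (zpToW p)

theorem sModEq_pow_iff_dvd_sub {N : ℕ} {x y : W p} :
    x ≡ y [SMOD Ideal.span {(p : W p)} ^ N • (⊤ : Ideal (W p))] ↔ (p : W p) ^ N ∣ x - y := by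
  rw [SModEq.sub_mem, smul_eq_mul, Ideal.mul_top, Ideal.span_singleton_pow,
    Ideal.mem_span_singleton]

theorem eq_zero_of_forall_pow_dvd {w : W p} (h : ∀ N : ℕ, (p : W p) ^ N ∣ w) : w = 0 :=
  IsHausdorff.haus (I := Ideal.span {(p : W p)}) inferInstance w fun N =>
    sModEq_pow_iff_dvd_sub.2 (by rw [sub_zero]; exact h N)

theorem HasPadicLimit.unique {u : ℕ → K p} {x y : K p} (hx : HasPadicLimit u x)
    (hy : HasPadicLimit u y) : x = y := by
  have hclose (N : ℕ) : ∃ w : W p, x - y = algebraMap (W p) (K p) (p ^ N * w) := by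
    obtain ⟨n, ⟨v, hv⟩, ⟨w, hw⟩⟩ := ((hx N).and (hy N)).exists
    refine ⟨w - v, ?_⟩
    rw [map_mul, map_sub, map_pow, map_natCast]
    linear_combination hw - hv
  obtain ⟨w, hw⟩ := hclose 0
  rw [pow_zero, one_mul] at hw
  have hw0 : w = 0 := eq_zero_of_forall_pow_dvd fun N => by
    obtain ⟨v, hv⟩ := hclose N
    rw [hw] at hv
    exact ⟨v, IsFractionRing.injective (W p) (K p) hv⟩
  rw [hw0, map_zero] at hw
  exact sub_eq_zero.1 hw

theorem HasPadicLimit.padicLimit_eq {u : ℕ → K p} {x : K p} (hx : HasPadicLimit u x) :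
    padicLimit u = x := by
  have h : ∃ x, HasPadicLimit u x := ⟨x, hx⟩
  rw [padicLimit, dif_pos h]
  exact h.choose_spec.unique hx

/-- The `p`-adic integer `p ^ k / (k + 1)`. -/
def powDivSucc (p : ℕ) [Fact p.Prime] (k : ℕ) : ℤ_[p] := (exists_pow_div_succ k).choose

theorem mul_powDivSucc (k : ℕ) : ((k + 1 : ℕ) : ℤ_[p]) * powDivSucc p k = p ^ k :=
  (exists_pow_div_succ k).choose_spec.1

theorem pow_dvd_powDivSucc {B k : ℕ} (h : 2 * B + 1 ≤ k) : (p : ℤ_[p]) ^ B ∣ powDivSucc p k :=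
  (exists_pow_div_succ k).choose_spec.2 B h

/-- The terms of the series for `p⁻¹ log (1 + p w)`, starting with `w` at index `0`. -/
def logTerm (w : W p) (k : ℕ) : W p := zpToW p ((-1) ^ k * powDivSucc p k) * w ^ (k + 1)

theorem pow_dvd_logTerm (w : W p) {B k : ℕ} (h : 2 * B + 1 ≤ k) : (p : W p) ^ B ∣ logTerm w k :=
  (pow_dvd_zpToW ((pow_dvd_powDivSucc h).mul_left _)).mul_right _

theorem neg_pow_div_eq_mul_logTerm (w : W p) (k : ℕ) :
    -((1 - algebraMap (W p) (K p) (1 + p * w)) ^ (k + 1) / ((k + 1 : ℕ) : K p)) =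
      p * algebraMap (W p) (K p) (logTerm w k) := by
  have hk : ((k + 1 : ℕ) : K p) ≠ 0 := by exact_mod_cast Nat.succ_ne_zero k
  have hq := congrArg (fun z => algebraMap (W p) (K p) (zpToW p z)) (mul_powDivSucc (p := p) k)
  simp only [map_mul, map_pow, map_natCast] at hq
  rw [neg_eq_iff_eq_neg, div_eq_iff hk]
  simp only [logTerm, map_mul, map_pow, map_add, map_one, map_natCast, map_neg]
  linear_combination (-1) ^ (k + 1) * (p : K p) * (algebraMap (W p) (K p) w) ^ (k + 1) * (-hq)

theorem exists_pow_dvd_sum_logTerm_sub (w : W p) :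
    ∃ x : W p, ∀ B M, 2 * B + 1 ≤ M → (p : W p) ^ B ∣ ∑ k ∈ Finset.range M, logTerm w k - x := by
  have hcauchy : ∀ B M N, 2 * B + 1 ≤ M → M ≤ N →
      (p : W p) ^ B ∣ ∑ k ∈ Finset.range M, logTerm w k - ∑ k ∈ Finset.range N, logTerm w k := by
    intro B M N hM hN
    rw [dvd_sub_comm, ← Finset.sum_Ico_eq_sub _ hN]
    exact Finset.dvd_sum fun k hk => pow_dvd_logTerm w (hM.trans (Finset.mem_Ico.1 hk).1)
  obtain ⟨x, hx⟩ := IsPrecomplete.prec (I := Ideal.span {(p : W p)}) inferInstance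
    (f := fun n => ∑ k ∈ Finset.range (2 * n + 1), logTerm w k)
    fun hmn => sModEq_pow_iff_dvd_sub.2 (hcauchy _ _ _ le_rfl (by lia))
  refine ⟨x, fun B M hM => ?_⟩
  have hsub := dvd_sub (sModEq_pow_iff_dvd_sub.1 (hx B)) (hcauchy B _ _ le_rfl hM)
  rwa [sub_sub_sub_cancel_left] at hsub

/-- The element `p⁻¹ log (1 + p w)` of `W`. -/
def logDivPrime (w : W p) : W p := (exists_pow_dvd_sum_logTerm_sub w).choose

theorem pow_dvd_sum_logTerm_sub (w : W p) {B M : ℕ} (hM : 2 * B + 1 ≤ M) :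
    (p : W p) ^ B ∣ ∑ k ∈ Finset.range M, logTerm w k - logDivPrime w :=
  (exists_pow_dvd_sum_logTerm_sub w).choose_spec B M hM

theorem iwasawaLog_one_add (w : W p) : iwasawaLog (algebraMap (W p) (K p) (1 + p * w)) =
    p * algebraMap (W p) (K p) (logDivPrime w) := by
  have hprincipal : IsPrincipalUnit (algebraMap (W p) (K p) (1 + p * w)) := ⟨w, by simp⟩
  rw [iwasawaLog, if_pos hprincipal, logSeries]
  refine HasPadicLimit.padicLimit_eq fun N => ?_
  filter_upwards [eventually_ge_atTop (2 * N + 1)] with M hM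
  obtain ⟨y, hy⟩ := pow_dvd_sum_logTerm_sub w hM
  refine ⟨p * y, ?_⟩
  rw [← Finset.Ico_succ_right_eq_Icc, Finset.sum_Ico_eq_sum_range, ← Finset.sum_neg_distrib]
  simp only [add_comm 1, neg_pow_div_eq_mul_logTerm]
  rw [Order.succ_eq_add_one, Nat.add_sub_cancel, ← Finset.mul_sum, ← map_sum, ← mul_sub, ← map_sub,
    hy]
  simp only [map_mul, map_pow, map_natCast]
  ring

theorem one_add_mul_pow_sub_one (w : W p) {m M : ℕ} (hM : m ≤ M) :
    (1 + (p : W p) * w) ^ m - 1 = ∑ k ∈ Finset.range M,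
      zpToW p (p ^ (k + 1) * (m.choose (k + 1) : ℕ)) * w ^ (k + 1) := by
  have hbinom : (1 + (p : W p) * w) ^ m =
      ∑ k ∈ Finset.range (M + 1), ((p : W p) * w) ^ k * (m.choose k : ℕ) := by
    rw [add_comm, add_pow]
    simp only [one_pow, mul_one]
    refine Finset.sum_subset (Finset.range_mono (by lia)) fun k _ hk => ?_
    rw [Nat.choose_eq_zero_of_lt (by simpa using hk), Nat.cast_zero, mul_zero]
  rw [hbinom, Finset.sum_range_succ']
  simp only [pow_zero, Nat.choose_zero_right, Nat.cast_one, mul_one, add_sub_cancel_right]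
  refine Finset.sum_congr rfl fun k _ => ?_
  rw [map_mul, map_pow, map_natCast, map_natCast]
  ring

theorem dvd_one_add_mul_pow_sub_one (w : W p) (m : ℕ) :
    ((p * m : ℕ) : W p) ∣ (1 + (p : W p) * w) ^ m - 1 := by
  rw [one_add_mul_pow_sub_one w le_rfl]
  refine Finset.dvd_sum fun k _ => Dvd.dvd.mul_right ?_ _
  simpa only [map_natCast] using map_dvd (zpToW p) (dvd_pow_mul_choose (p := p) m k)

theorem sq_dvd_two_mul_sub_logTerm (w : W p) (m k : ℕ) : ((p * m : ℕ) : W p) ^ 2 ∣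
    2 * (zpToW p (p ^ (k + 1) * (m.choose (k + 1) : ℕ)) * w ^ (k + 1) -
      (p * m : ℕ) * logTerm w k) := by
  have hterm := map_dvd (zpToW p) (sq_dvd_two_mul_choose_sub m k (mul_powDivSucc k))
  rw [map_pow, map_natCast, map_mul, map_sub, map_mul (zpToW p) ((p * m : ℕ) : ℤ_[p]),
    map_natCast (zpToW p) (p * m), map_ofNat] at hterm
  convert hterm.mul_right (w ^ (k + 1)) using 1
  rw [logTerm]
  ring

theorem sq_dvd_two_mul_pow_sub (w : W p) (m : ℕ) : ((p * m : ℕ) : W p) ^ 2 ∣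
    2 * ((1 + (p : W p) * w) ^ m - 1 - (p * m : ℕ) * logDivPrime w) := by
  rcases Nat.eq_zero_or_pos m with rfl | hm
  · simp
  have hpm : ((p * m : ℕ) : ℤ_[p]) ^ 2 ≠ 0 := pow_ne_zero _ (by
    exact_mod_cast Nat.mul_ne_zero (Fact.out : p.Prime).ne_zero hm.ne')
  obtain ⟨B, -, hB⟩ := exists_pow_dvd hpm
  have hBW : ((p * m : ℕ) : W p) ^ 2 ∣ (p : W p) ^ B := by
    simpa only [map_pow, map_natCast] using map_dvd (zpToW p) hB
  set M := m + (2 * B + 1)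
  have htail := hBW.trans (pow_dvd_sum_logTerm_sub w (Nat.le_add_left (2 * B + 1) m))
  have hterms : ((p * m : ℕ) : W p) ^ 2 ∣ ∑ k ∈ Finset.range M,
      2 * (zpToW p (p ^ (k + 1) * (m.choose (k + 1) : ℕ)) * w ^ (k + 1) -
        (p * m : ℕ) * logTerm w k) :=
    Finset.dvd_sum fun k _ => sq_dvd_two_mul_sub_logTerm w m k
  convert dvd_add hterms (htail.mul_left (2 * (p * m : ℕ))) using 1
  rw [one_add_mul_pow_sub_one w (Nat.le_add_right m (2 * B + 1)), ← Finset.mul_sum,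
    Finset.sum_sub_distrib, ← Finset.mul_sum]
  ring

end Log

section ApproxExp

variable {R : Type*} [CommRing R] {p : ℕ}

theorem natCast_dvd_pow (hp : p.Prime) (hunit : ∀ x : ℕ, ¬ p ∣ x → IsUnit (x : R)) {n x : ℕ}
    (hx : ¬ p ^ n ∣ x) : (x : R) ∣ (p : R) ^ n := by
  have hx0 : x ≠ 0 := fun h0 => hx (h0 ▸ dvd_zero _)
  obtain ⟨e, y, hy, rfl⟩ := Nat.exists_eq_pow_mul_and_not_dvd hx0 p hp.ne_one
  have hen : e ≤ n := by
    by_contra! hne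
    exact hx ((pow_dvd_pow p hne.le).mul_right y)
  rw [Nat.cast_mul, Nat.cast_pow, (hunit y hy).mul_right_dvd]
  exact pow_dvd_pow _ hen

/-- The function `f` on `ℕ` behaves like `m ↦ exp (-p m θ₀)` up to terms of second order in `p m`
and up to a factor `2`. -/
structure ApproxExp (p : ℕ) (f : ℕ → R) (θ₀ : R) : Prop where
  dvd_one_sub : ∀ m, ((p * m : ℕ) : R) ∣ 1 - f m
  sq_dvd : ∀ m, ((p * m : ℕ) : R) ^ 2 ∣ 2 * (f m - (1 - (p * m : ℕ) * θ₀))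
  mul_dvd : ∀ m n, ((p * m : ℕ) : R) * (p * n : ℕ) ∣ 2 * (f (m + n) - f m * f n)

namespace ApproxExp

variable {f : ℕ → R} {θ₀ : R}

/-- The quotient `(1 - f m) / (p m)`, extended by `θ₀` at `m = 0`. -/
def slope (h : ApproxExp p f θ₀) (m : ℕ) : R := if m = 0 then θ₀ else (h.dvd_one_sub m).choose

theorem slope_zero (h : ApproxExp p f θ₀) : h.slope 0 = θ₀ := if_pos rfl

theorem mul_slope (h : ApproxExp p f θ₀) (m : ℕ) : ((p * m : ℕ) : R) * h.slope m = 1 - f m := by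
  rw [slope]
  split_ifs with hm
  · have h0 := h.dvd_one_sub 0
    rw [mul_zero, Nat.cast_zero, zero_dvd_iff] at h0
    rw [hm, h0, mul_zero, Nat.cast_zero, zero_mul]
  · exact (h.dvd_one_sub m).choose_spec.symm

theorem exists_mul_slope_add_sub_eq (h : ApproxExp p f θ₀) (m k : ℕ) : ∃ E : R,
    ((p * (m + k) : ℕ) : R) * (2 * (h.slope (m + k) - h.slope m)) =
      (2 * (h.slope k - h.slope m) - (p * m : ℕ) * E) * (p * k : ℕ) := by
  obtain ⟨E, hE⟩ := h.mul_dvd m k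
  have hadd : ((p * (m + k) : ℕ) : R) = (p * m : ℕ) + (p * k : ℕ) := by push_cast; ring
  refine ⟨2 * h.slope m * h.slope k + E, ?_⟩
  linear_combination 2 * h.mul_slope (m + k) - hE - 2 * h.slope m * hadd -
    2 * (1 - (p * k : ℕ) * h.slope k) * h.mul_slope m - 2 * f m * h.mul_slope k

variable [IsDomain R] [CharZero R]

theorem dvd_two_mul_slope_sub (h : ApproxExp p f θ₀) (hp : p ≠ 0) (m : ℕ) :
    ((p * m : ℕ) : R) ∣ 2 * (h.slope m - θ₀) := by
  rcases eq_or_ne m 0 with rfl | hm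
  · simp [slope_zero]
  have hpm : ((p * m : ℕ) : R) ≠ 0 := by exact_mod_cast Nat.mul_ne_zero hp hm
  obtain ⟨y, hy⟩ := h.sq_dvd m
  refine ⟨-y, mul_left_cancel₀ hpm ?_⟩
  linear_combination 2 * h.mul_slope m - hy

theorem pow_dvd_two_mul_slope_add_sub (h : ApproxExp p f θ₀) (hp : p.Prime)
    (hunit : ∀ x : ℕ, ¬ p ∣ x → IsUnit (x : R)) {n m k : ℕ} (hk : p ^ n ∣ p * k) :
    (p : R) ^ n ∣ 2 * (h.slope (m + k) - h.slope m) := by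
  have hslope {q : R} {x y : ℕ} (hx : q ∣ ((p * x : ℕ) : R)) (hy : q ∣ ((p * y : ℕ) : R)) :
      q ∣ 2 * (h.slope x - h.slope y) := by
    have := dvd_sub (hx.trans (h.dvd_two_mul_slope_sub hp.ne_zero x))
      (hy.trans (h.dvd_two_mul_slope_sub hp.ne_zero y))
    rwa [← mul_sub, sub_sub_sub_cancel_right] at this
  have hcast {x : ℕ} (hx : p ^ n ∣ x) : (p : R) ^ n ∣ (x : R) := by
    exact_mod_cast Nat.cast_dvd_cast (α := R) hx
  by_cases hm : p ^ n ∣ p * m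
  · exact hslope (hcast (by rw [mul_add]; exact dvd_add hm hk)) (hcast hm)
  have hmk : ¬ p ^ n ∣ p * (m + k) := by rwa [mul_add, Nat.dvd_add_left hk]
  set A : R := ((p * (m + k) : ℕ) : R) with hA_def
  have hA : A ∣ (p : R) ^ n := natCast_dvd_pow hp hunit hmk
  have hA_dvd : A ∣ ((p * m : ℕ) : R) := by
    rw [← dvd_add_left (hA.trans (hcast hk)), hA_def, mul_add, Nat.cast_add]
  have hA0 : A ≠ 0 := ne_zero_of_dvd_ne_zero (pow_ne_zero n (by exact_mod_cast hp.ne_zero)) hA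
  obtain ⟨E, hE⟩ := h.exists_mul_slope_add_sub_eq m k
  rw [← mul_dvd_mul_iff_left hA0, hE]
  refine mul_dvd_mul (dvd_sub (hA_dvd.trans ?_) (hA_dvd.mul_right E)) (hcast hk)
  exact hslope ((natCast_dvd_pow hp hunit hm).trans (hcast hk)) dvd_rfl

theorem pow_dvd_two_mul_slope_sub (h : ApproxExp p f θ₀) (hp : p.Prime)
    (hunit : ∀ x : ℕ, ¬ p ∣ x → IsUnit (x : R)) {n m m' : ℕ}
    (hmod : p * m ≡ p * m' [MOD p ^ n]) : (p : R) ^ n ∣ 2 * (h.slope m - h.slope m') := by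
  wlog hle : m' ≤ m generalizing m m'
  · rw [← dvd_neg, ← mul_neg, neg_sub]
    exact this hmod.symm (by lia)
  obtain ⟨k, rfl⟩ := Nat.exists_eq_add_of_le hle
  have hk := (Nat.modEq_iff_dvd' (Nat.mul_le_mul_left p hle)).1 hmod.symm
  rw [mul_add, Nat.add_sub_cancel_left] at hk
  exact h.pow_dvd_two_mul_slope_add_sub hp hunit hk

end ApproxExp

end ApproxExp

section CoefQuotient

variable {p : ℕ} [Fact p.Prime] {ι : Type*} [Fintype ι]

theorem approxExp_pow_mul_invRatio (a b : ι → ℤ_[p]) (w : W p) :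
    ApproxExp p (fun m => (1 + (p : W p) * w) ^ m * zpToW p (invRatio a b (p * m)))
      (zpToW p (∑ i, psiInt (a i) - ∑ i, psiInt (b i)) - logDivPrime w) where
  dvd_one_sub m := by
    have hratio := map_dvd (zpToW p) (dvd_invRatio_sub_one a b (dvd_mul_right p m))
    rw [map_natCast, map_sub, map_one] at hratio
    obtain ⟨y, hy⟩ := hratio
    obtain ⟨z, hz⟩ := dvd_one_add_mul_pow_sub_one w m
    refine ⟨-(z * zpToW p (invRatio a b (p * m)) + y), ?_⟩
    linear_combination -(zpToW p (invRatio a b (p * m))) * hz - hy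
  sq_dvd m := by
    have hratio := map_dvd (zpToW p) (sq_dvd_invRatio_sub a b (dvd_mul_right p m))
    rw [map_pow, map_natCast, map_sub, map_sub, map_mul, map_natCast, map_one] at hratio
    obtain ⟨y, hy⟩ := hratio
    obtain ⟨z, hz⟩ := sq_dvd_two_mul_pow_sub w m
    set t := zpToW p (∑ i, psiInt (a i) - ∑ i, psiInt (b i))
    set x := logDivPrime w
    set P := ((p * m : ℕ) : W p)
    refine ⟨z * zpToW p (invRatio a b (p * m)) + 2 * (1 + P * x) * y - 2 * x * t, ?_⟩
    linear_combination (zpToW p (invRatio a b (p * m))) * hz + 2 * (1 + P * x) * hy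
  mul_dvd m n := by
    have hratio := map_dvd (zpToW p)
      (mul_dvd_invRatio_add a b (dvd_mul_right p m) (dvd_mul_right p n))
    rw [map_mul, map_natCast, map_natCast, map_mul, map_sub, map_mul, map_ofNat, ← mul_add]
      at hratio
    obtain ⟨y, hy⟩ := hratio
    refine ⟨(1 + (p : W p) * w) ^ (m + n) * y, ?_⟩
    rw [pow_add]
    linear_combination (1 + (p : W p) * w) ^ m * (1 + (p : W p) * w) ^ n * hy

/-- The quotient of the `k`-th coefficient of `G`, for `c = 1 + p w`, by that of `F`, where `b`
includes the parameter `1` coming from `n!`. -/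
def coefQuotient (a b : ι → ℤ_[p]) (w : W p) (k : ℕ) : W p :=
  if p ∣ k then (approxExp_pow_mul_invRatio a b w).slope (k / p) else zpToW p (unitInv (k : ℤ_[p]))

theorem twiceCongr_coefQuotient (a b : ι → ℤ_[p]) (w : W p) :
    TwiceCongr p (coefQuotient a b w) := by
  intro n x y hxy
  rcases eq_or_ne n 0 with rfl | hn
  · simp
  have hdvd : p ∣ x ↔ p ∣ y := (hxy.of_dvd (dvd_pow_self p hn)).dvd_iff dvd_rfl
  simp only [coefQuotient, hdvd]
  split_ifs with hy
  · refine (approxExp_pow_mul_invRatio a b w).pow_dvd_two_mul_slope_sub Fact.out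
      (fun _ => isUnit_natCast_W) ?_
    rwa [Nat.mul_div_cancel' hy, Nat.mul_div_cancel' (hdvd.2 hy)]
  · rw [← map_sub]
    refine (pow_dvd_zpToW (unitInv_congr (dvd_pow_self _ hn) ?_)).mul_left 2
    exact_mod_cast (PadicInt.pow_p_dvd_int_iff (p := p) n ((x : ℤ) - y)).2
      (by exact_mod_cast Nat.modEq_iff_dvd.1 hxy.symm)

end CoefQuotient

section Conditions

theorem card_filter_comp_perm {ι : Type*} [Fintype ι] (e : Equiv.Perm ι) (P : ι → Prop)
    [DecidablePred P] :
    (Finset.univ.filter fun i => P (e i)).card = (Finset.univ.filter P).card :=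
  Finset.card_equiv e (by simp)

theorem card_lt_card_of_sort_lt {m q l : ℕ} (u : Fin (m + 1) → ℕ) (v : Fin m → ℕ)
    (h : ∀ j : Fin m, (j : ℕ) < q → u (Tuple.sort u j.succ) < v (Tuple.sort v j))
    {S : Finset (Fin m)} (hS : S.Nonempty) (hSq : S.card ≤ q) (hSl : ∀ j ∈ S, v j ≤ l) :
    S.card < (Finset.univ.filter fun i => u i < l).card := by
  have hpos : 0 < S.card := hS.card_pos
  have hle : S.card ≤ m := by simpa using Finset.card_le_univ S
  let j : Fin m := ⟨S.card - 1, by lia⟩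
  have hj : (j : ℕ) + 1 = S.card := Nat.sub_add_cancel hpos
  have hv : v (Tuple.sort v j) ≤ l := by
    have hcount : S.card ≤ (Finset.univ.filter fun i => v i ≤ l).card :=
      Finset.card_le_card fun i hi => Finset.mem_filter.2 ⟨Finset.mem_univ i, hSl i hi⟩
    rw [← card_filter_comp_perm (Tuple.sort v)] at hcount
    exact (Tuple.lt_card_le_iff_apply_le_of_monotone (f := v ∘ Tuple.sort v)
      (Tuple.monotone_sort v)).1 (by simpa only [Function.comp_apply] using by lia)
  have hu : u (Tuple.sort u j.succ) < l := (h j (by lia)).trans_le hv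
  have hcount := (Tuple.lt_card_lt_iff_apply_lt_of_monotone (f := u ∘ Tuple.sort u)
    (Tuple.monotone_sort u)).2 hu
  simp only [Function.comp_apply] at hcount
  rwa [card_filter_comp_perm (Tuple.sort u) (fun i => u i < l), Fin.val_succ, hj] at hcount

variable {p : ℕ} [Fact p.Prime] {r : ℕ}

/-- The lower parameters together with the parameter `1` coming from `n!`. -/
def lowerParams (b : Fin r → ℤ_[p]) : Fin (r + 1) → ℤ_[p] := Fin.cons 1 b

theorem lowerParams_zero (b : Fin r → ℤ_[p]) : lowerParams b 0 = 1 := rfl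

theorem lowerParams_succ (b : Fin r → ℤ_[p]) (j : Fin r) : lowerParams b j.succ = b j := rfl

open Classical in
theorem DworkConditions.card_lt_card {a : Fin (r + 1) → ℤ_[p]} {b : Fin r → ℤ_[p]}
    (hab : DworkConditions a b) {n l : ℕ}
    (hne : ∃ j, lowerParams b j ≠ 1 ∧ dworkDigit n (lowerParams b j) ≤ l) :
    (Finset.univ.filter fun j =>
        lowerParams b j ≠ 1 ∧ dworkDigit n (lowerParams b j) ≤ l).card <
      (Finset.univ.filter fun i => dworkDigit n (a i) < l).card := by
  set S : Finset (Fin r) := Finset.univ.filter fun j => b j ≠ 1 ∧ dworkDigit n (b j) ≤ l with hS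
  have hmap : (Finset.univ.filter fun j =>
      lowerParams b j ≠ 1 ∧ dworkDigit n (lowerParams b j) ≤ l) = S.map (Fin.succEmb r) := by
    ext i
    cases i using Fin.cases with
    | zero => simp [lowerParams_zero]
    | succ i => simp [lowerParams_succ, hS]
  have hSne : S.Nonempty := by
    obtain ⟨j, hj⟩ := hne
    rw [← Finset.map_nonempty (f := Fin.succEmb r), ← hmap]
    exact ⟨j, Finset.mem_filter.2 ⟨Finset.mem_univ j, hj⟩⟩
  rw [hmap, Finset.card_map]
  refine card_lt_card_of_sort_lt (fun i => dworkDigit n (a i)) (fun j => dworkDigit n (b j))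
    (hab.digit_lt n _ _ (Tuple.monotone_sort fun i => dworkDigit n (a i))
      (Tuple.monotone_sort fun j => dworkDigit n (b j))) hSne ?_
    fun j hj => (Finset.mem_filter.1 hj).2.2
  rw [← Set.ncard_coe_finset]
  exact Set.ncard_le_ncard
    (fun j hj => (Finset.mem_filter.1 (Finset.mem_coe.1 hj)).2.1) (Set.toFinite _)

open Classical in
theorem DworkConditions.dworkData {a : Fin (r + 1) → ℤ_[p]} {b : Fin r → ℤ_[p]}
    (hab : DworkConditions a b) (hb : ∀ (j : Fin r) (m : ℕ), b j ≠ -(m : ℤ_[p]))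
    (ha : ∀ (i : Fin (r + 1)) (m : ℕ), a i ≠ -(m : ℤ_[p])) :
    DworkData a (lowerParams b) (Finset.univ.filter fun j => lowerParams b j ≠ 1) where
  num_ne := ha
  den_ne i m := by
    cases i using Fin.cases with
    | zero =>
      rw [lowerParams_zero, Ne, eq_neg_iff_add_eq_zero, add_comm]
      exact Nat.cast_add_one_ne_zero m
    | succ j => exact hb j m
  norm_eq_one j hj := by
    cases j using Fin.cases with
    | zero => simp [lowerParams_zero] at hj
    | succ j => exact hab.norm_eq_one j (Finset.mem_filter.1 hj).2
  eq_one j hj := by simpa using hj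
  card_lt n l hne := by
    simp only [Finset.mem_filter, Finset.mem_univ, true_and] at hne
    simpa only [Finset.filter_filter] using hab.card_lt_card hne

theorem coeff_hypSeries_iter (a : Fin (r + 1) → ℤ_[p]) (b : Fin r → ℤ_[p]) (k n : ℕ) :
    coeff n (hypSeries (fun i => dworkIter k (a i)) fun j => dworkIter k (b j)) =
      coefIter a (lowerParams b) k n := by
  rw [hypSeries, coeff_mk, coefIter, coefRatio, Fin.prod_univ_succ (n := r) (f := fun i =>
    (ascPochhammer ℚ_[p] n).eval (dworkIter k (lowerParams b i) : ℚ_[p]))]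
  simp only [lowerParams_zero, lowerParams_succ, dworkIter_one, PadicInt.coe_one]
  rw [mul_comm ((ascPochhammer ℚ_[p] n).eval 1)]

end Conditions

section Lift

variable {p : ℕ} [Fact p.Prime]

theorem frobenius_zpToW (x : ℤ_[p]) : WittVector.frobenius (zpToW p x) = zpToW p x := by
  change WittVector.frobenius (WittVector.map _ _) = WittVector.map _ _
  ext n
  rw [WittVector.coeff_frobenius_charP, WittVector.map_coeff, ← map_pow, ZMod.pow_card]

theorem frobenius_algebraMap_zpToW (x : ℤ_[p]) :
    WittVector.FractionRing.frobenius p (AlgebraicClosure (ZMod p))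
      (algebraMap (W p) (K p) (zpToW p x)) = algebraMap (W p) (K p) (zpToW p x) := by
  rw [WittVector.FractionRing.frobenius, IsFractionRing.ringEquivOfRingEquiv_algebraMap]
  exact congrArg _ (frobenius_zpToW x)

theorem psiInt_one : psiInt (1 : ℤ_[p]) = 0 := by
  have hdvd (w : ℕ) : (p : ℤ_[p]) ^ w ∣ 2 * psiInt (1 : ℤ_[p]) := by
    obtain ⟨n, hn, hψ⟩ := (psiTilde_spec (1 : ℤ_[p])).choose_spec.2 (w + 1)
    rw [sub_add_cancel_left, dvd_neg] at hn
    have hharm := pow_dvd_two_mul_unitHarmonic_sub (p := p) (m := n) (n := 0) (Nat.succ_ne_zero w)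
      (by rwa [Nat.cast_zero, sub_zero])
    rw [show unitHarmonic (1 : ℤ_[p]) 0 = 0 from Finset.sum_range_zero _, sub_zero] at hharm
    convert (pow_dvd_pow _ (Nat.le_succ w)).trans (dvd_add (hψ.mul_left 2) hharm) using 1
    rw [psiInt]
    ring
  have hzero := eq_zero_of_forall_pow_dvd fun w => pow_dvd_zpToW (hdvd w)
  rw [map_eq_zero_iff _ (zpToW_injective p)] at hzero
  exact (mul_eq_zero.1 hzero).resolve_left two_ne_zero

theorem digamma_eq (z : ℤ_[p]) :
    digamma z = -eulerConst p + algebraMap (W p) (K p) (zpToW p (psiInt z)) := by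
  rw [digamma, ← coe_psiInt, qpToK_coe]

theorem natCast_mul_coefQuotient {ι : Type*} [Fintype ι] (a b : ι → ℤ_[p]) (w : W p) (k : ℕ) :
    (k : W p) * coefQuotient a b w k =
      1 - if p ∣ k then (1 + (p : W p) * w) ^ (k / p) * zpToW p (invRatio a b k) else 0 := by
  rw [coefQuotient]
  split_ifs with hk
  · simpa only [Nat.mul_div_cancel' hk] using
      (approxExp_pow_mul_invRatio a b w).mul_slope (k / p)
  · have hinv := congrArg (zpToW p) (mul_unitInv (mt (natCast_dvd_natCast_iff k).1 hk))
    rwa [map_mul, map_natCast, map_one, ← sub_zero (1 : W p)] at hinv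

theorem coeff_zero_hypG {r : ℕ} (a : Fin (r + 1) → ℤ_[p]) (b : Fin r → ℤ_[p])
    (w : W p) :
    coeff 0 (hypG (1 + (p : W p) * w) a b) =
      algebraMap (W p) (K p) (coefQuotient a (lowerParams b) w 0) := by
  have hp0 : (p : K p) ≠ 0 := by exact_mod_cast (Fact.out : p.Prime).ne_zero
  rw [hypG, iwasawaLog_one_add, map_add, coeff_zero_C, logIntegral, coeff_mk, Nat.cast_zero,
    div_zero, add_zero, inv_mul_cancel_left₀ hp0, coefQuotient, if_pos (dvd_zero p), Nat.zero_div,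
    ApproxExp.slope_zero, Fin.sum_univ_succ (fun i => psiInt (lowerParams b i))]
  simp only [digamma_eq, lowerParams_zero, lowerParams_succ, psiInt_one, zero_add, map_sub,
    map_sum, Finset.sum_add_distrib, Finset.sum_const, Finset.card_univ, Fintype.card_fin,
    nsmul_eq_mul]
  push_cast
  ring

namespace DworkData

theorem coef_one_eq {ι : Type*} [Fintype ι] {a b : ι → ℤ_[p]} {J : Finset ι}
    (h : DworkData a b J) (m : ℕ) : h.coef 1 m = h.coef 0 (p * m) * invRatio a b (p * m) := by
  refine PadicInt.ext ?_
  have hstep : coefIter a b 0 (p * m) = coefIter a b 1 m * unitRatio a b (p * m) := by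
    have := coefRatio_step a b (Nat.zero_le p) m
    simp only [carryCount, carryProd, not_lt_zero, Finset.filter_false, Finset.card_empty,
      Finset.prod_empty, pow_zero, one_mul, mul_one, div_one, zero_add] at this
    rwa [mul_comm m] at this
  rw [PadicInt.coe_mul]
  change coefIter a b 1 m = coefIter a b 0 (p * m) * _
  rw [hstep, mul_assoc, unitRatio_mul_invRatio, mul_one]

variable {r : ℕ} {a : Fin (r + 1) → ℤ_[p]} {b : Fin r → ℤ_[p]} {J : Finset (Fin (r + 1))}

theorem coeff_hypFIter (h : DworkData a (lowerParams b) J) (k n : ℕ) :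
    coeff n (hypFIter k a b) = algebraMap (W p) (K p) (zpToW p (h.coef k n)) := by
  rw [hypFIter, hypF, PowerSeries.coeff_map, coeff_hypSeries_iter, ← qpToK_coe]
  rfl

theorem coeff_hypF (h : DworkData a (lowerParams b) J) (n : ℕ) :
    coeff n (hypF a b) = algebraMap (W p) (K p) (zpToW p (h.coef 0 n)) :=
  h.coeff_hypFIter 0 n

theorem coeff_sigma_hypFIter_one (h : DworkData a (lowerParams b) J) (c : W p) (k : ℕ) :
    coeff k (sigma c (hypFIter 1 a b)) = algebraMap (W p) (K p) (zpToW p (h.coef 0 k) *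
      if p ∣ k then c ^ (k / p) * zpToW p (invRatio a (lowerParams b) k) else 0) := by
  rw [sigma, coeff_mk]
  split_ifs with hk
  · rw [h.coeff_hypFIter, frobenius_algebraMap_zpToW, h.coef_one_eq, Nat.mul_div_cancel' hk,
      ← map_pow, ← map_mul, map_mul (zpToW p)]
    ring_nf
  · rw [mul_zero, map_zero]

theorem coeff_hypG (h : DworkData a (lowerParams b) J) (w : W p) (k : ℕ) :
    coeff k (hypG (1 + (p : W p) * w) a b) = algebraMap (W p) (K p)
      (zpToW p (h.coef 0 k) * coefQuotient a (lowerParams b) w k) := by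
  rcases eq_or_ne k 0 with rfl | hk
  · rw [coeff_zero_hypG, h.coef_zero, map_one, one_mul]
  have hk0 : (k : K p) ≠ 0 := by exact_mod_cast hk
  rw [hypG, map_add, PowerSeries.coeff_C, if_neg hk, zero_add, logIntegral, coeff_mk, map_sub,
    h.coeff_hypF, h.coeff_sigma_hypFIter_one, ← map_sub, div_eq_iff hk0,
    ← map_natCast (algebraMap (W p) (K p)), ← map_mul, mul_assoc, mul_comm _ (k : W p),
    natCast_mul_coefQuotient, mul_sub, mul_one]

/-- The series `F`, with coefficients in `W`. -/
def liftF (h : DworkData a (lowerParams b) J) : (W p)⟦X⟧ :=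
  PowerSeries.mk fun n => zpToW p (h.coef 0 n)

/-- The series `G` for `c = 1 + p w`, with coefficients in `W`. -/
def liftG (h : DworkData a (lowerParams b) J) (w : W p) : (W p)⟦X⟧ :=
  PowerSeries.mk fun n => zpToW p (h.coef 0 n) * coefQuotient a (lowerParams b) w n

theorem coeff_zero_liftF (h : DworkData a (lowerParams b) J) : coeff 0 h.liftF = 1 := by
  rw [liftF, coeff_mk, h.coef_zero, map_one]

theorem hypF_eq_map (h : DworkData a (lowerParams b) J) :
    hypF a b = PowerSeries.map (algebraMap (W p) (K p)) h.liftF := by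
  ext n
  rw [PowerSeries.coeff_map, liftF, coeff_mk, h.coeff_hypF]

theorem hypG_eq_map (h : DworkData a (lowerParams b) J) (w : W p) :
    hypG (1 + (p : W p) * w) a b = PowerSeries.map (algebraMap (W p) (K p)) (h.liftG w) := by
  ext n
  rw [PowerSeries.coeff_map, liftG, coeff_mk, h.coeff_hypG]

theorem C_pow_dvd_two_mul (h : DworkData a (lowerParams b) J) (w : W p) (n : ℕ) :
    PowerSeries.C ((p : W p) ^ n) ∣ 2 * (h.liftG w * truncSeries (p ^ n) h.liftF -
      h.liftF * truncSeries (p ^ n) (h.liftG w)) := by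
  refine (twiceCongr_coefQuotient a (lowerParams b) w).C_pow_dvd_two_mul (Fact.out : p.Prime).pos
    (C := fun d n => zpToW p (h.coef d n)) (fun d => by rw [h.coef_zero, map_one])
    (fun d s l hl N => ?_) n
  simpa only [map_sum, map_sub, map_mul] using pow_dvd_zpToW (h.dvd_sum_range hl s N)

end DworkData

end Lift

section Quotient

variable {p : ℕ} [Fact p.Prime]

theorem truncLT_map (P : ℕ) (f : (W p)⟦X⟧) :
    truncLT P (PowerSeries.map (algebraMap (W p) (K p)) f) =
      PowerSeries.map (algebraMap (W p) (K p)) (truncSeries P f) := by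
  ext n
  rw [PowerSeries.coeff_map, coeff_truncSeries, truncLT, Polynomial.coeff_coe, coeff_trunc,
    PowerSeries.coeff_map, apply_ite (algebraMap (W p) (K p)), map_zero]

theorem map_mul_inv_map {f g h : (W p)⟦X⟧} (hfg : f * g = 1) :
    PowerSeries.map (algebraMap (W p) (K p)) h * (PowerSeries.map (algebraMap (W p) (K p)) f)⁻¹ =
      PowerSeries.map (algebraMap (W p) (K p)) (h * g) := by
  have hunit := (IsUnit.of_mul_eq_one g hfg).map (PowerSeries.map (algebraMap (W p) (K p)))
  rw [eq_comm, PowerSeries.eq_mul_inv_iff_mul_eq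
    (PowerSeries.isUnit_iff_constantCoeff.1 hunit).ne_zero, ← map_mul, mul_assoc, mul_comm g, hfg,
    mul_one]

theorem isIntegralSeries_map_mul_inv {F G : (W p)⟦X⟧} (hF : coeff 0 F = 1) :
    IsIntegralSeries (PowerSeries.map (algebraMap (W p) (K p)) G *
      (PowerSeries.map (algebraMap (W p) (K p)) F)⁻¹) := by
  obtain ⟨u, hu⟩ := (isUnit_of_coeff_zero hF).exists_right_inv
  exact ⟨G * u, map_mul_inv_map hu⟩

theorem congrModPow_map_mul_inv {m P : ℕ} (hP : 0 < P) {F G : (W p)⟦X⟧} (hF : coeff 0 F = 1)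
    (h : PowerSeries.C ((p : W p) ^ m) ∣ G * truncSeries P F - F * truncSeries P G) :
    CongrModPow m (PowerSeries.map (algebraMap (W p) (K p)) G *
        (PowerSeries.map (algebraMap (W p) (K p)) F)⁻¹)
      (truncLT P (PowerSeries.map (algebraMap (W p) (K p)) G) *
        (truncLT P (PowerSeries.map (algebraMap (W p) (K p)) F))⁻¹) := by
  obtain ⟨u, hu⟩ := (isUnit_of_coeff_zero hF).exists_right_inv
  obtain ⟨v, hv⟩ := (isUnit_truncSeries hP hF).exists_right_inv
  obtain ⟨y, hy⟩ := h
  have hsub : G * u - truncSeries P G * v = PowerSeries.C ((p : W p) ^ m) * (y * u * v) := by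
    linear_combination u * v * hy - G * u * hv + truncSeries P G * v * hu
  refine ⟨y * u * v, ?_⟩
  rw [truncLT_map, truncLT_map, map_mul_inv_map hu, map_mul_inv_map hv, ← map_sub, hsub, map_mul,
    PowerSeries.map_C, map_pow, map_natCast]

theorem isUnit_two_of_ne_two (hp : p ≠ 2) : IsUnit (2 : (W p)⟦X⟧) := by
  have hunit : IsUnit ((2 : ℕ) : W p) := isUnit_natCast_W fun hdvd =>
    hp ((Nat.prime_dvd_prime_iff_eq Fact.out Nat.prime_two).1 hdvd)
  have hmap := hunit.map (PowerSeries.C (R := W p))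
  rwa [map_natCast, Nat.cast_ofNat] at hmap

theorem C_pow_sub_one_dvd_of_two_mul (hp : p = 2) {n : ℕ} (hn : 1 ≤ n) {f : (W p)⟦X⟧}
    (h : PowerSeries.C ((p : W p) ^ n) ∣ 2 * f) : PowerSeries.C ((p : W p) ^ (n - 1)) ∣ f := by
  have htwo : (2 : (W p)⟦X⟧) = PowerSeries.C (p : W p) := by
    rw [map_natCast]
    exact_mod_cast congrArg (Nat.cast (R := (W p)⟦X⟧)) hp.symm
  have hne : (2 : (W p)⟦X⟧) ≠ 0 := by
    rw [htwo, Ne, map_eq_zero_iff _ PowerSeries.C_injective]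
    exact_mod_cast (Fact.out : p.Prime).ne_zero
  rwa [← Nat.sub_add_cancel hn, pow_succ', map_mul, ← htwo, mul_dvd_mul_iff_left hne] at h

end Quotient

end LogHyp

end

theorem theorem1p1 (p : ℕ) [Fact p.Prime] (r : ℕ)
    (a : Fin (r + 1) → ℤ_[p]) (b : Fin r → ℤ_[p])
    (hb : ∀ (j : Fin r) (m : ℕ), b j ≠ -(m : ℤ_[p]))
    (hab : LogHyp.DworkConditions a b)
    (ha : ∀ (i : Fin (r + 1)) (m : ℕ), a i ≠ -(m : ℤ_[p]))
    (c : LogHyp.W p) (hc : ∃ w : LogHyp.W p, c = 1 + (p : LogHyp.W p) * w) :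
    LogHyp.IsIntegralSeries (LogHyp.logTypeHyp c a b) ∧
    (p ≠ 2 → ∀ n : ℕ, 1 ≤ n →
      LogHyp.CongrModPow n (LogHyp.logTypeHyp c a b)
        (LogHyp.truncLT (p ^ n) (LogHyp.hypG c a b) *
          (LogHyp.truncLT (p ^ n) (LogHyp.hypF a b))⁻¹)) ∧
    (p = 2 → ∀ n : ℕ, 1 ≤ n →
      LogHyp.CongrModPow (n - 1) (LogHyp.logTypeHyp c a b)
        (LogHyp.truncLT (p ^ n) (LogHyp.hypG c a b) *
          (LogHyp.truncLT (p ^ n) (LogHyp.hypF a b))⁻¹)) := by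
  classical
  obtain ⟨w, rfl⟩ := hc
  have h := hab.dworkData hb ha
  have hpos (n : ℕ) : 0 < p ^ n := pow_pos (Fact.out : p.Prime).pos n
  rw [LogHyp.logTypeHyp, h.hypF_eq_map, h.hypG_eq_map]
  refine ⟨LogHyp.isIntegralSeries_map_mul_inv h.coeff_zero_liftF, fun hp n _ => ?_,
    fun hp n hn => ?_⟩
  · exact LogHyp.congrModPow_map_mul_inv (hpos n) h.coeff_zero_liftF
      ((LogHyp.isUnit_two_of_ne_two hp).dvd_mul_left.1 (h.C_pow_dvd_two_mul w n))
  · exact LogHyp.congrModPow_map_mul_inv (hpos n) h.coeff_zero_liftF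
      (LogHyp.C_pow_sub_one_dvd_of_two_mul hp hn (h.C_pow_dvd_two_mul w n))
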